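/- **Theorem.** Let $K$ be a field, let $m\ge n\ge 1$ be integers, and let $G=K_{m,n}$ be the complete bipartite graph on the vertex set $\{1,\dots,m\}\cup\{m+1,\dots,m+n\}$. Let $S=K[x_1,\dots,x_{m+n},y_1,\dots,y_{m+n}]$ be the standard graded polynomial ring with the lexicographic order $<$ induced by $x_1>\cdots>x_{m+n}>y_1>\cdots>y_{m+n}$, let $J_G\subset S$ be the binomial edge ideal, generated by the binomials $x_iy_j-x_jy_i$ with $\{i,j\}$ an edge of $G$, and let $\mathrm{in}_<(J_G)$ be its initial ideal. Then $\mathrm{in}_<(J_G)$ has a minimal graded free resolution by finitely generated graded free $S$-modules, and its graded Betti numbers $\beta_{t,d}(\mathrm{in}_<(J_G))$ (the number of basis elements of degree $d$ in homological position $t$ of any such resolution) are as follows. For every integer $t\ge 0$, \[ \beta_{t,t+2}(\mathrm{in}_<(J_G))=\sum_{\substack{1\le i\le m\\ m+1\le j\le m+n}}\binom{i+j-m-2}{t}, \] \[ \beta_{t,t+3}(\mathrm{in}_<(J_G))= \begin{cases} \displaystyle\sum_{\substack{1\le i<j\le m\\ 1\le k\le n}}\binom{n+k+j-3}{t}, &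 \text{if } n=1,\\[3ex] \displaystyle\sum_{\substack{1\le i<j\le m\\ 1\le k\le n}}\binom{n+k+j-3}{t}+\sum_{\substack{1\le i<j\le n\\ 1\le k\le m}}\binom{m+k+j-3}{t}, & \text{if } n>1, \end{cases} \] and $\beta_{t,d}(\mathrm{in}_<(J_G))=0$ for every integer $d\ge 0$ with $d\notin\{t+2,t+3\}$. -/

import Mathlib

/-- The variables `x_v` and `y_v` for `v : V`, as the lexicographic sum of two copies of `V`:
every `x` comes before every `y`, and within each copy the order is that of `V`. -/
abbrev EdgeVar (V : Type*) : Type _ := V ⊕ₗ V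

/-- The variable `x_v`. -/
noncomputable def xVar (K : Type*) [Field K] {V : Type*} (v : V) : MvPolynomial (EdgeVar V) K :=
  MvPolynomial.X (Sum.inlₗ v)

/-- The variable `y_v`. -/
noncomputable def yVar (K : Type*) [Field K] {V : Type*} (v : V) : MvPolynomial (EdgeVar V) K :=
  MvPolynomial.X (Sum.inrₗ v)

/-- The binomial edge ideal `J_G`, generated by the binomials `x_i y_j - x_j y_i` with `{i, j}`
an edge of `G`. -/
noncomputable def binomialEdgeIdeal (K : Type*) [Field K] {V : Type*} (G : SimpleGraph V) :
    Ideal (MvPolynomial (EdgeVar V) K) :=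
  Ideal.span {f | ∃ i j : V, G.Adj i j ∧ f = xVar K i * yVar K j - xVar K j * yVar K i}

/-- The initial ideal of `J` for a monomial order: the ideal generated by the leading terms of
all elements of `J`. -/
noncomputable def initialIdeal {σ K : Type*} [Field K] (ord : MonomialOrder σ) (J : Ideal (MvPolynomial σ K)) :
    Ideal (MvPolynomial σ K) :=
  Ideal.span (ord.leadingTerm '' (J : Set (MvPolynomial σ K)))

/-- The lexicographic order on `K[x_1, …, x_N, y_1, …, y_N]` induced by
`x_1 > ⋯ > x_N > y_1 > ⋯ > y_N`. (`MonomialOrder.lex` makes smaller indices into larger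
variables.) -/
noncomputable def edgeLex (N : ℕ) : MonomialOrder (EdgeVar (Fin N)) :=
  haveI : Finite (EdgeVar (Fin N)) := inferInstanceAs (Finite (Fin N ⊕ Fin N))
  MonomialOrder.lex

/-- The complete bipartite graph `K_{m,n}` on `m + n` vertices labelled by `Fin (m + n)`: the
first `m` vertices form one side and the last `n` vertices the other. -/
def bipartiteGraph (m n : ℕ) : SimpleGraph (Fin (m + n)) :=
  (completeBipartiteGraph (Fin m) (Fin n)).map finSumFinEquiv.toEmbedding

/-- A minimal graded free resolution
`⋯ → F_2 → F_1 → F_0 → I → 0` of an ideal `I` of the polynomial ring `S = K[σ]` by finitely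
generated graded free modules. The module `F_t` is `ι t → S`, its basis element `e_a` is
homogeneous of degree `deg t a`; the augmentation `F_0 → I` sends `e_a` to `gen a`, and
`diff t : F_{t+1} → F_t` is given by a matrix. -/
structure MinimalGradedFreeResolution {σ K : Type*} [Field K] (I : Ideal (MvPolynomial σ K)) where
  /-- the basis of `F_t` -/
  ι : ℕ → Type
  [fintype_ι : ∀ t, Fintype (ι t)]
  /-- the degrees of the basis elements of `F_t` -/
  deg : ∀ t, ι t → ℕ
  /-- the images in `I` of the basis elements of `F_0` -/
  gen : ι 0 → MvPolynomial σ K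
  /-- the matrix of the differential `F_{t+1} → F_t` -/
  diff : ∀ t, Matrix (ι t) (ι (t + 1)) (MvPolynomial σ K)
  /-- the augmentation is homogeneous of degree zero -/
  gen_homogeneous : ∀ a, (gen a).IsHomogeneous (deg 0 a)
  /-- the differentials are homogeneous of degree zero: the entry of `diff t` in row `a` and
  column `b` is homogeneous of degree `deg (t + 1) b - deg t a` (and is zero if this is
  negative) -/
  diff_homogeneous : ∀ t a b, ∀ u ∈ (diff t a b).support, u.degree + deg t a = deg (t + 1) b
  /-- the augmentation maps onto `I` -/
  span_gen : Ideal.span (Set.range gen) = I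
  /-- exactness at `F_0` -/
  exact_zero : ∀ v : ι 0 → MvPolynomial σ K,
    ∑ a, v a * gen a = 0 ↔ ∃ w, (diff 0).mulVec w = v
  /-- exactness at `F_{t+1}` -/
  exact_succ : ∀ t, ∀ v : ι (t + 1) → MvPolynomial σ K,
    (diff t).mulVec v = 0 ↔ ∃ w, (diff (t + 1)).mulVec w = v
  /-- minimality: the image of `F_{t+1}` in `F_t` lies in `𝔪 F_t`, where `𝔪` is the ideal
  generated by the variables -/
  minimal : ∀ t a b, diff t a b ∈ MvPolynomial.idealOfVars σ K

attribute [instance] MinimalGradedFreeResolution.fintype_ι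

/-- The number of basis elements of degree `d` in the `t`-th module of the resolution. For a
minimal graded free resolution of `I` this is the graded Betti number `β_{t,d}(I)`. -/
def MinimalGradedFreeResolution.betti {σ K : Type*} [Field K] {I : Ideal (MvPolynomial σ K)}
    (F : MinimalGradedFreeResolution I) (t d : ℕ) : ℕ :=
  (Finset.univ.filter fun a : F.ι t => F.deg t a = d).card

/-! The initial ideal is generated by monomials of three kinds (`initialIdeal_bipartiteGraph`): `x_i
y_j` across the two sides, `x_b x_i y_j` with `i < j` on the left and `b` on the right, and `y_a x_i
y_j` with `i < j` on the right and `a` on the left. Explicit combinations of edge binomials show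
that these are leading monomials. Conversely, a linear functional summing coefficients over classes
of monomials modulo `x_i y_j = x_j y_i` kills `J_G`. A monomial with no factor `x_i y_j`, `i < j`,
is lex-smallest in its class, so it cannot lead an element of `J_G`. Every element of `J_G` also
involves variables from both sides in each of its terms, and a short case analysis then produces one
of the listed generators as a divisor.

Taken block by block, each block in lexicographic order of its indices, these generators have linear
quotients: the colon ideal of each by its predecessors is generated by a set of variables. Adding a
generator of degree `e` whose colon ideal is generated by `q` variables amounts to a mapping cone
over a Koszul complex. The degrees leave no room for unit entries, so the cone stays minimal and
adds `q.choose t` to the Betti number in position `t`, degree `t + e` (`exists_sup_span_singleton`,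
`exists_linearQuotients`).

Counting the variables in each colon ideal gives the binomial sums. The result holds for every
minimal resolution because lifts of the identity are the identity modulo the variables (`betti_eq`).
-/

namespace MvPolynomial

/-! ### Graded pieces of polynomials and homogeneous linear systems -/

variable {σ K : Type*} [Field K]

/-- The part of `p` of degree `d`, where the degrees are shifted by `k`. -/
noncomputable def shiftedComponent (k d : ℕ) (p : MvPolynomial σ K) : MvPolynomial σ K :=
  if k ≤ d then homogeneousComponent (d - k) p else 0

/-- The degree condition is additive, in the style of `diff_homogeneous`, so that truncated
subtraction plays no role from here on. -/
theorem coeff_shiftedComponent (k d : ℕ) (p : MvPolynomial σ K) (u : σ →₀ ℕ) :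
    coeff u (shiftedComponent k d p) = if u.degree + k = d then coeff u p else 0 := by
  unfold shiftedComponent
  split_ifs with h1 h2 h2
  · rw [coeff_homogeneousComponent, if_pos (by omega)]
  · rw [coeff_homogeneousComponent, if_neg (by omega)]
  · omega
  · simp

/-- A form of degree `l - k` shifts all degrees uniformly, so multiplying by it commutes with
extracting graded pieces. This is what lets a solution of a homogeneous system be truncated to a
homogeneous one. -/
theorem mul_shiftedComponent {k l : ℕ} (d : ℕ) {q : MvPolynomial σ K}
    (hq : ∀ u ∈ q.support, u.degree + k = l) (p : MvPolynomial σ K) :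
    q * shiftedComponent l d p = shiftedComponent k d (q * p) := by
  classical
  ext u
  rw [coeff_shiftedComponent, coeff_mul, coeff_mul]
  have hsum : ∀ (c : Prop) [Decidable c] (s : Finset ((σ →₀ ℕ) × (σ →₀ ℕ))) (g : _ → K),
      (if c then ∑ x ∈ s, g x else 0) = ∑ x ∈ s, if c then g x else 0 := by
    intro c _ s g
    split_ifs <;> simp
  rw [hsum]
  refine Finset.sum_congr rfl fun x hx => ?_
  rw [coeff_shiftedComponent]
  by_cases h0 : coeff x.1 q = 0
  · simp [h0]
  have h := hq x.1 (mem_support_iff.2 h0)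
  have hu : u.degree = x.1.degree + x.2.degree := by
    rw [← Finset.HasAntidiagonal.mem_antidiagonal.1 hx, map_add]
  have : (x.2.degree + l = d) ↔ (u.degree + k = d) := by omega
  simp [this]

theorem shiftedComponent_eq_self {k d : ℕ} {p : MvPolynomial σ K}
    (hp : ∀ u ∈ p.support, u.degree + k = d) : shiftedComponent k d p = p := by
  ext u
  rw [coeff_shiftedComponent]
  split_ifs with h
  · rfl
  · by_contra h'
    exact h (hp u (mem_support_iff.2 fun h => h' h.symm))

theorem shiftedComponent_sum {α : Type*} (s : Finset α) (k d : ℕ) (f : α → MvPolynomial σ K) :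
    shiftedComponent k d (∑ a ∈ s, f a) = ∑ a ∈ s, shiftedComponent k d (f a) := by
  unfold shiftedComponent
  split_ifs <;> simp

theorem degree_add_of_mem_support_shiftedComponent {k d : ℕ} {p : MvPolynomial σ K} {u : σ →₀ ℕ}
    (hu : u ∈ (shiftedComponent k d p).support) : u.degree + k = d := by
  by_contra h
  rw [mem_support_iff, coeff_shiftedComponent, if_neg h] at hu
  exact hu rfl

theorem degree_add_of_mem_support_mul {p q : MvPolynomial σ K} {k l r : ℕ}
    (hp : ∀ u ∈ p.support, u.degree + k = l) (hq : ∀ u ∈ q.support, u.degree + l = r) :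
    ∀ u ∈ (p * q).support, u.degree + k = r := by
  classical
  intro u hu
  obtain ⟨a, ha, b, hb, rfl⟩ := Finset.mem_add.1 (support_mul p q hu)
  have := hp a ha
  have := hq b hb
  rw [map_add]
  omega

theorem degree_add_of_mem_support_sum {α : Type*} {s : Finset α} {f : α → MvPolynomial σ K}
    {k r : ℕ} (hf : ∀ a ∈ s, ∀ u ∈ (f a).support, u.degree + k = r) :
    ∀ u ∈ (∑ a ∈ s, f a).support, u.degree + k = r := by
  classical
  intro u hu
  obtain ⟨a, ha, h⟩ := Finset.mem_biUnion.1 (support_sum hu)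
  exact hf a ha u h

theorem IsHomogeneous.degree_eq {p : MvPolynomial σ K} {d : ℕ} (hp : p.IsHomogeneous d)
    {u : σ →₀ ℕ} (hu : u ∈ p.support) : u.degree = d := by
  rw [← hp (mem_support_iff.1 hu), Finsupp.degree_eq_weight_one]
  rfl

theorem mem_idealOfVars_iff_constantCoeff {p : MvPolynomial σ K} :
    p ∈ idealOfVars σ K ↔ constantCoeff p = 0 := by
  rw [idealOfVars, ← Set.image_univ, mem_ideal_span_X_image]
  constructor
  · intro h
    by_contra h0
    obtain ⟨i, -, hi⟩ := h 0 (mem_support_iff.2 (by rwa [constantCoeff_eq] at h0))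
    simp at hi
  · intro h u hu
    have : u ≠ 0 := by
      rintro rfl
      exact mem_support_iff.1 hu (by rwa [constantCoeff_eq] at h)
    obtain ⟨i, hi⟩ := DFunLike.ne_iff.1 this
    exact ⟨i, trivial, hi⟩

/-- A matrix which is homogeneous of degree zero can be solved degree by degree. -/
theorem exists_homogeneous_mulVec {α β : Type*} [Fintype β] (r : α → ℕ) (c : β → ℕ)
    {A : Matrix α β (MvPolynomial σ K)}
    (hA : ∀ a b, ∀ u ∈ (A a b).support, u.degree + r a = c b) {d : ℕ}
    {v : α → MvPolynomial σ K} (hv : ∀ a, ∀ u ∈ (v a).support, u.degree + r a = d)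
    {w : β → MvPolynomial σ K} (hw : A.mulVec w = v) :
    ∃ w' : β → MvPolynomial σ K,
      (∀ b, ∀ u ∈ (w' b).support, u.degree + c b = d) ∧ A.mulVec w' = v := by
  refine ⟨fun b => shiftedComponent (c b) d (w b),
    fun b u hu => degree_add_of_mem_support_shiftedComponent hu, ?_⟩
  ext1 a
  rw [← shiftedComponent_eq_self (hv a), ← hw]
  simp only [Matrix.mulVec, dotProduct, shiftedComponent_sum]
  exact Finset.sum_congr rfl fun b _ => mul_shiftedComponent d (hA a b) (w b)

end MvPolynomial

/-! ### Lifting maps to resolutions, and independence of the Betti numbers -/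

namespace MinimalGradedFreeResolution

open MvPolynomial Matrix

variable {σ K : Type*} [Field K] {I Q : Ideal (MvPolynomial σ K)}

theorem mem_iff (F : MinimalGradedFreeResolution I) {f : MvPolynomial σ K} :
    f ∈ I ↔ ∃ v : F.ι 0 → MvPolynomial σ K, ∑ a, v a * F.gen a = f := by
  have h : f ∈ Ideal.span (Set.range F.gen) ↔ f ∈ I := by rw [F.span_gen]
  rw [← h]
  exact Submodule.mem_span_range_iff_exists_fun _

theorem gen_mem (F : MinimalGradedFreeResolution I) (a : F.ι 0) : F.gen a ∈ I :=
  F.span_gen.le (Ideal.subset_span ⟨a, rfl⟩)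

theorem diff_mul_diff (F : MinimalGradedFreeResolution I) (t : ℕ) :
    F.diff t * F.diff (t + 1) = 0 := by
  classical
  ext1 a b
  have := (F.exact_succ t (fun a => F.diff (t + 1) a b)).2 ⟨Pi.single b 1, by ext1; simp⟩
  exact congrFun this a

theorem exists_diff_mul_eq (F : MinimalGradedFreeResolution I) (t : ℕ) {α : Type*}
    (A : Matrix (F.ι (t + 1)) α (MvPolynomial σ K)) (hA : F.diff t * A = 0) :
    ∃ B : Matrix (F.ι (t + 2)) α (MvPolynomial σ K), F.diff (t + 1) * B = A := by
  have h : ∀ b, ∃ w, F.diff (t + 1) *ᵥ w = fun a => A a b := fun b =>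
    (F.exact_succ t _).1 (funext fun a => congrFun (congrFun hA a) b)
  choose w hw using h
  exact ⟨Matrix.of fun a b => w b a, by ext1 a b; exact congrFun (hw b) a⟩

/-- The matrices `φ t : Q_t → F_t` form a homogeneous map of complexes which lifts the
multiplication by `f`, of degree `e`. -/
structure IsLift (G : MinimalGradedFreeResolution Q) (F : MinimalGradedFreeResolution I)
    (f : MvPolynomial σ K) (e : ℕ)
    (φ : ∀ t, Matrix (F.ι t) (G.ι t) (MvPolynomial σ K)) : Prop where
  homogeneous : ∀ t a b, ∀ u ∈ (φ t a b).support, u.degree + F.deg t a = G.deg t b + e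
  gen : ∀ b, ∑ a, φ 0 a b * F.gen a = f * G.gen b
  comm : ∀ t, F.diff t * φ (t + 1) = φ t * G.diff t

/-- The comparison theorem: free modules lift along an exact complex one position at a time, and
homogeneous entries can be chosen at each stage. -/
theorem exists_isLift (G : MinimalGradedFreeResolution Q) (F : MinimalGradedFreeResolution I)
    {f : MvPolynomial σ K} {e : ℕ} (hf : f.IsHomogeneous e) (hQ : ∀ q ∈ Q, f * q ∈ I) :
    ∃ φ, IsLift G F f e φ := by
  -- The second clause of this invariant is exactly the solvability needed to choose the next
  -- matrix, so the recursion can run on a subtype.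
  let P : ∀ t, Matrix (F.ι t) (G.ι t) (MvPolynomial σ K) → Prop := fun t φ =>
    (∀ a b, ∀ u ∈ (φ a b).support, u.degree + F.deg t a = G.deg t b + e) ∧
    ∀ w, ∃ w', F.diff t *ᵥ w' = φ *ᵥ (G.diff t *ᵥ w)
  have zero : ∃ φ, P 0 φ ∧ ∀ b, ∑ a, φ a b * F.gen a = f * G.gen b := by
    have h : ∀ b, ∃ w : F.ι 0 → MvPolynomial σ K,
        (∀ a, ∀ u ∈ (w a).support, u.degree + F.deg 0 a = G.deg 0 b + e) ∧
        (Matrix.of fun (_ : Unit) a => F.gen a) *ᵥ w = fun _ => f * G.gen b := by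
      intro b
      obtain ⟨v, hv⟩ := F.mem_iff.1 (hQ _ (G.gen_mem b))
      refine exists_homogeneous_mulVec (fun _ => 0) (F.deg 0) (w := v) ?_ ?_ ?_
      · intro _ a u hu
        exact IsHomogeneous.degree_eq (F.gen_homogeneous a) hu
      · intro _ u hu
        rw [add_zero, add_comm (G.deg 0 b)]
        exact IsHomogeneous.degree_eq (hf.mul (G.gen_homogeneous b)) hu
      · ext1
        rw [← hv]
        simp [Matrix.mulVec, dotProduct, mul_comm]
    choose w hw hw' using h
    have key : ∀ b, ∑ a, w b a * F.gen a = f * G.gen b := fun b => by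
      rw [← congrFun (hw' b) ()]
      simp [Matrix.mulVec, dotProduct, mul_comm]
    refine ⟨Matrix.of fun a b => w b a, ⟨fun a b => hw b a, fun v => ?_⟩, key⟩
    refine (F.exact_zero _).1 ?_
    have h0 := (G.exact_zero (G.diff 0 *ᵥ v)).2 ⟨v, rfl⟩
    generalize G.diff 0 *ᵥ v = z at h0 ⊢
    calc ∑ a, ((Matrix.of fun a b => w b a) *ᵥ z) a * F.gen a
        = ∑ a, ∑ b, w b a * z b * F.gen a := by
          simp [Matrix.mulVec, dotProduct, Finset.sum_mul]
      _ = ∑ b, z b * ∑ a, w b a * F.gen a := by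
          rw [Finset.sum_comm]
          simp only [Finset.mul_sum]
          exact Finset.sum_congr rfl fun _ _ => Finset.sum_congr rfl fun _ _ => by ring
      _ = f * ∑ b, z b * G.gen b := by
          rw [Finset.mul_sum]
          exact Finset.sum_congr rfl fun b _ => by rw [key]; ring
      _ = 0 := by rw [h0, mul_zero]
  have succ : ∀ t (φ : {φ // P t φ}), ∃ ψ : {ψ // P (t + 1) ψ},
      F.diff t * ψ.1 = φ.1 * G.diff t := by
    rintro t ⟨φ, hφ, hφ'⟩
    have h : ∀ b, ∃ w : F.ι (t + 1) → MvPolynomial σ K,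
        (∀ a, ∀ u ∈ (w a).support, u.degree + F.deg (t + 1) a = G.deg (t + 1) b + e) ∧
        F.diff t *ᵥ w = fun a => (φ * G.diff t) a b := by
      intro b
      classical
      obtain ⟨w, hw⟩ := hφ' (Pi.single b 1)
      refine exists_homogeneous_mulVec (F.deg t) (F.deg (t + 1)) (F.diff_homogeneous t) (w := w)
        (fun a => ?_) ?_
      · refine degree_add_of_mem_support_sum fun c _ =>
          degree_add_of_mem_support_mul (hφ a c) fun u hu => ?_
        have := G.diff_homogeneous t c b u hu
        omega
      · rw [hw, Matrix.mulVec_mulVec]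
        ext1 a
        simp
    choose w hw hw' using h
    have key : F.diff t * (Matrix.of fun a b => w b a) = φ * G.diff t := by
      ext1 a b
      exact congrFun (hw' b) a
    refine ⟨⟨Matrix.of fun a b => w b a, fun a b => hw b a, fun v => ?_⟩, key⟩
    refine (F.exact_succ t _).1 ?_
    rw [Matrix.mulVec_mulVec, key, ← Matrix.mulVec_mulVec, Matrix.mulVec_mulVec _ (G.diff t),
      G.diff_mul_diff, Matrix.zero_mulVec, Matrix.mulVec_zero]
  obtain ⟨φ₀, h₀, h₀'⟩ := zero
  choose next hnext using succ
  let φ : ∀ t, {φ // P t φ} := fun t => Nat.rec ⟨φ₀, h₀⟩ next t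
  exact ⟨fun t => (φ t).1, fun t => (φ t).2.1, h₀', fun t => hnext t (φ t)⟩

theorem IsLift.comp {I' : Ideal (MvPolynomial σ K)} {H : MinimalGradedFreeResolution I'}
    {G : MinimalGradedFreeResolution Q} {F : MinimalGradedFreeResolution I}
    {φ : ∀ t, Matrix (F.ι t) (G.ι t) (MvPolynomial σ K)}
    {ψ : ∀ t, Matrix (G.ι t) (H.ι t) (MvPolynomial σ K)}
    (hφ : IsLift G F 1 0 φ) (hψ : IsLift H G 1 0 ψ) : IsLift H F 1 0 fun t => φ t * ψ t where
  homogeneous t a b := degree_add_of_mem_support_sum fun c _ =>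
    degree_add_of_mem_support_mul (hφ.homogeneous t a c) (hψ.homogeneous t c b)
  gen b := by
    rw [← hψ.gen b]
    simp only [Matrix.mul_apply, Finset.sum_mul]
    rw [Finset.sum_comm]
    refine Finset.sum_congr rfl fun c _ => ?_
    rw [← one_mul (G.gen c), ← hφ.gen c, Finset.mul_sum]
    exact Finset.sum_congr rfl fun _ _ => by ring
  comm t := by
    rw [← Matrix.mul_assoc, hφ.comm, Matrix.mul_assoc, hψ.comm, Matrix.mul_assoc]

/-- A lift of the identity is the identity modulo the variables. -/
theorem IsLift.map_constantCoeff_eq_one {F : MinimalGradedFreeResolution I} [∀ t, DecidableEq (F.ι t)]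
    {φ : ∀ t, Matrix (F.ι t) (F.ι t) (MvPolynomial σ K)} (hφ : IsLift F F 1 0 φ) (t : ℕ) :
    (φ t).map constantCoeff = 1 := by
  have hdiff : ∀ t, (F.diff t).map (constantCoeff (R := K)) = 0 := fun t => by
    ext a b
    exact mem_idealOfVars_iff_constantCoeff.1 (F.minimal t a b)
  -- The witness is a homotopy from `φ` to the identity, built along the induction. The first clause
  -- makes the next defect `φ (t + 1) - 1 - h * F.diff t` a cycle. By minimality every term of the
  -- homotopy formula containing a differential vanishes modulo the variables.
  suffices h : ∃ h : Matrix (F.ι (t + 1)) (F.ι t) (MvPolynomial σ K),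
      (φ t - 1 - F.diff t * h) * F.diff t = 0 ∧ (φ t).map constantCoeff = 1 from h.choose_spec.2
  induction t with
  | zero =>
    have h : ∀ b, ∃ w, F.diff 0 *ᵥ w = fun a => (φ 0 - 1) a b := fun b => by
      refine (F.exact_zero _).1 ?_
      simp only [Matrix.sub_apply, sub_mul, Finset.sum_sub_distrib, hφ.gen, one_mul]
      simp [Matrix.one_apply]
    choose w hw using h
    have key : φ 0 - 1 = F.diff 0 * (Matrix.of fun a b => w b a) := by
      ext1 a b
      exact (congrFun (hw b) a).symm
    refine ⟨_, by rw [← key, sub_self, Matrix.zero_mul], ?_⟩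
    have := congrArg (fun M => M.map (constantCoeff (R := K))) key
    simp only [Matrix.map_mul, hdiff, Matrix.zero_mul] at this
    rw [Matrix.map_sub _ (map_sub _), Matrix.map_one _ (map_zero _) (map_one _)] at this
    exact sub_eq_zero.1 this
  | succ t ih =>
    obtain ⟨h, h0, -⟩ := ih
    obtain ⟨h', hh⟩ := F.exists_diff_mul_eq t (φ (t + 1) - 1 - h * F.diff t) (by
      rw [← h0, Matrix.mul_sub, Matrix.mul_sub, hφ.comm, Matrix.sub_mul, Matrix.sub_mul,
        Matrix.mul_one, Matrix.one_mul, Matrix.mul_assoc])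
    refine ⟨h', ?_, ?_⟩
    · have : φ (t + 1) - 1 - F.diff (t + 1) * h' = h * F.diff t := by
        rw [hh]; abel
      rw [this, Matrix.mul_assoc, F.diff_mul_diff, Matrix.mul_zero]
    · have := congrArg (fun M => M.map (constantCoeff (R := K))) hh
      simp only [Matrix.map_mul, hdiff, Matrix.zero_mul] at this
      rw [Matrix.map_sub _ (map_sub _), Matrix.map_sub _ (map_sub _),
        Matrix.map_one _ (map_zero _) (map_one _), Matrix.map_mul, hdiff, Matrix.mul_zero,
        sub_zero] at this
      exact sub_eq_zero.1 this.symm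

/-- The graded Betti numbers do not depend on the resolution. -/
theorem betti_eq (F G : MinimalGradedFreeResolution I) (t d : ℕ) :
    F.betti t d = G.betti t d := by
  classical
  obtain ⟨φ, hφ⟩ := exists_isLift F G (isHomogeneous_one σ K) fun q hq => by rwa [one_mul]
  obtain ⟨ψ, hψ⟩ := exists_isLift G F (isHomogeneous_one σ K) fun q hq => by rwa [one_mul]
  -- Modulo the variables the two lifts are mutually inverse, and so are their degree `d` blocks.
  -- Matrices over `K` inverse to each other on both sides are square, which compares the ranks.
  have block : ∀ {F G : MinimalGradedFreeResolution I}
      {φ : ∀ t, Matrix (G.ι t) (F.ι t) (MvPolynomial σ K)}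
      {ψ : ∀ t, Matrix (F.ι t) (G.ι t) (MvPolynomial σ K)}, IsLift F G 1 0 φ →
      IsLift G F 1 0 ψ →
      (((ψ t).map (constantCoeff (R := K))).submatrix Subtype.val Subtype.val :
          Matrix {a : F.ι t // F.deg t a = d} {b : G.ι t // G.deg t b = d} K) *
        (((φ t).map (constantCoeff (R := K))).submatrix Subtype.val Subtype.val :
          Matrix {b : G.ι t // G.deg t b = d} {a : F.ι t // F.deg t a = d} K) = 1 := by
    intro F G φ ψ hφ hψ
    ext a b
    have h1 := congrFun (congrFun ((hψ.comp hφ).map_constantCoeff_eq_one t) a) b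
    rw [Matrix.map_mul] at h1
    have h2 : (1 : Matrix (F.ι t) (F.ι t) K) a b =
        (1 : Matrix {a : F.ι t // F.deg t a = d} _ K) a b := by
      simp [Matrix.one_apply, Subtype.ext_iff]
    rw [← h2, ← h1]
    simp only [Matrix.mul_apply, Matrix.submatrix_apply, Matrix.map_apply]
    rw [← Finset.sum_subtype (Finset.univ.filter fun c => G.deg t c = d) (by simp)
      fun c => constantCoeff (ψ t a.1 c) * constantCoeff (φ t c b.1)]
    -- A nonzero constant entry joins basis elements of equal degree, so the intermediate indices
    -- outside degree `d` contribute nothing.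
    refine Finset.sum_filter_of_ne fun c _ hc => ?_
    by_contra hne
    refine hc ?_
    have : constantCoeff (φ t c b.1) = 0 := by
      rw [constantCoeff_eq]
      by_contra h0
      have := hφ.homogeneous t c b.1 0 (mem_support_iff.2 h0)
      rw [map_zero, b.2] at this
      omega
    rw [this, mul_zero]
  rw [betti, betti, ← Fintype.card_subtype, ← Fintype.card_subtype]
  exact Matrix.square_of_invertible _ _ (block hφ hψ) (block hψ hφ)

/-! ### Mapping cones, Koszul resolutions and linear quotients -/

theorem IsLift.sum_mulVec_mul_gen {F : MinimalGradedFreeResolution I}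
    {G : MinimalGradedFreeResolution Q} {f : MvPolynomial σ K} {e : ℕ}
    {φ : ∀ t, Matrix (F.ι t) (G.ι t) (MvPolynomial σ K)} (hφ : IsLift G F f e φ)
    (q : G.ι 0 → MvPolynomial σ K) :
    ∑ a, (φ 0 *ᵥ q) a * F.gen a = f * ∑ b, q b * G.gen b := by
  rw [Finset.mul_sum]
  simp only [Matrix.mulVec, dotProduct, Finset.sum_mul]
  rw [Finset.sum_comm]
  refine Finset.sum_congr rfl fun b _ => ?_
  rw [mul_left_comm, ← hφ.gen, Finset.mul_sum]
  exact Finset.sum_congr rfl fun _ _ => by ring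

/-- Exactness of a mapping cone. -/
theorem IsLift.fromBlocks_mulVec_eq_zero_iff {F : MinimalGradedFreeResolution I}
    {G : MinimalGradedFreeResolution Q} {f : MvPolynomial σ K} {e : ℕ}
    {φ : ∀ t, Matrix (F.ι t) (G.ι t) (MvPolynomial σ K)} (hφ : IsLift G F f e φ) {t : ℕ}
    {α : Type*} {B : Matrix α (G.ι t) (MvPolynomial σ K)}
    (hB : ∀ y, B *ᵥ y = 0 ↔ ∃ z, G.diff t *ᵥ z = y)
    (v : F.ι (t + 1) ⊕ G.ι t → MvPolynomial σ K) :
    fromBlocks (F.diff t) (-φ t) 0 B *ᵥ v = 0 ↔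
      ∃ w, fromBlocks (F.diff (t + 1)) (-φ (t + 1)) 0 (-G.diff t) *ᵥ w = v := by
  have hcomm : ∀ z, F.diff t *ᵥ (φ (t + 1) *ᵥ z) = φ t *ᵥ (G.diff t *ᵥ z) := fun z => by
    rw [Matrix.mulVec_mulVec, hφ.comm, Matrix.mulVec_mulVec]
  constructor
  · intro h
    rw [Matrix.fromBlocks_mulVec] at h
    have h1 : F.diff t *ᵥ (v ∘ Sum.inl) + -φ t *ᵥ (v ∘ Sum.inr) = 0 :=
      funext fun a => congrFun h (Sum.inl a)
    have h2 : (0 : Matrix α (F.ι (t + 1)) (MvPolynomial σ K)) *ᵥ (v ∘ Sum.inl) +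
        B *ᵥ (v ∘ Sum.inr) = 0 := funext fun a => congrFun h (Sum.inr a)
    rw [Matrix.zero_mulVec, zero_add] at h2
    rw [Matrix.neg_mulVec, ← sub_eq_add_neg, sub_eq_zero] at h1
    obtain ⟨z, hz⟩ := (hB _).1 h2
    -- Once the `G`-component is written as a boundary of `z`, subtracting the image of `z` turns
    -- the `F`-component into a cycle.
    obtain ⟨w, hw⟩ := (F.exact_succ t (v ∘ Sum.inl - φ (t + 1) *ᵥ z)).1 (by
      rw [Matrix.mulVec_sub, hcomm, hz, h1, sub_self])
    refine ⟨Sum.elim w (-z), ?_⟩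
    rw [Matrix.fromBlocks_mulVec]
    ext1 (a | a)
    · simp [hw, Matrix.neg_mulVec, Matrix.mulVec_neg]
    · simp [hz, Matrix.neg_mulVec, Matrix.mulVec_neg]
  · rintro ⟨w, rfl⟩
    rw [Matrix.fromBlocks_mulVec, Matrix.fromBlocks_mulVec]
    have h1 := (F.exact_succ t _).2 ⟨w ∘ Sum.inl, rfl⟩
    have h2 := (hB _).2 ⟨w ∘ Sum.inr, rfl⟩
    simp only [Sum.elim_comp_inl, Sum.elim_comp_inr, Matrix.zero_mulVec, zero_add,
      Matrix.neg_mulVec, Matrix.mulVec_add, Matrix.mulVec_neg, neg_neg, h1, h2, hcomm]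
    ext1 (a | a) <;> simp

/-- If `Q = (I : f)`, then a resolution of `I + (f)` is the mapping cone of a lift of the
multiplication by `f`. -/
noncomputable def mappingCone (F : MinimalGradedFreeResolution I)
    (G : MinimalGradedFreeResolution Q) {f : MvPolynomial σ K} {e : ℕ} (hf : f.IsHomogeneous e)
    (hQ : ∀ q, q ∈ Q ↔ f * q ∈ I) {φ : ∀ t, Matrix (F.ι t) (G.ι t) (MvPolynomial σ K)}
    (hφ : IsLift G F f e φ) (hdeg : ∀ t a b, F.deg t a < G.deg t b + e)
    (hpos : ∀ b, 0 < G.deg 0 b) : MinimalGradedFreeResolution (I ⊔ Ideal.span {f}) where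
  ι
    | 0 => F.ι 0 ⊕ Unit
    | t + 1 => F.ι (t + 1) ⊕ G.ι t
  fintype_ι
    | 0 => inferInstanceAs (Fintype (F.ι 0 ⊕ Unit))
    | t + 1 => inferInstanceAs (Fintype (F.ι (t + 1) ⊕ G.ι t))
  deg
    | 0 => Sum.elim (F.deg 0) fun _ => e
    | t + 1 => Sum.elim (F.deg (t + 1)) fun b => G.deg t b + e
  gen := Sum.elim F.gen fun _ => f
  diff
    | 0 => Matrix.fromBlocks (F.diff 0) (-φ 0) 0 (Matrix.of fun _ b => G.gen b)
    | t + 1 => Matrix.fromBlocks (F.diff (t + 1)) (-φ (t + 1)) 0 (-G.diff t)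
  gen_homogeneous := by
    rintro (a | _)
    · exact F.gen_homogeneous a
    · exact hf
  diff_homogeneous := by
    rintro (_ | t) (a | a) (b | b) u hu
    · exact F.diff_homogeneous 0 a b u hu
    · exact hφ.homogeneous 0 a b u (by simpa using hu)
    · simp at hu
    · simp only [Sum.elim_inr]
      rw [IsHomogeneous.degree_eq (G.gen_homogeneous b) hu]
    · exact F.diff_homogeneous (t + 1) a b u hu
    · exact hφ.homogeneous (t + 1) a b u (by simpa using hu)
    · simp at hu
    · have := G.diff_homogeneous t a b u (by simpa using hu)
      simp only [Sum.elim_inr]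
      omega
  span_gen := by
    rw [Set.Sum.elim_range, Ideal.span_union, F.span_gen, Set.range_const]
  exact_zero v := by
    constructor
    · intro h
      change ∑ a : F.ι 0 ⊕ Unit, v a * Sum.elim F.gen (fun _ => f) a = 0 at h
      simp only [Fintype.sum_sum_type, Sum.elim_inl, Sum.elim_inr, Finset.univ_unique,
        Finset.sum_singleton] at h
      -- In a syzygy of the enlarged generating set, the coefficient of `f` multiplies `f` into `I`;
      -- this is where the colon ideal enters.
      have hq : v (Sum.inr ()) ∈ Q := by
        rw [hQ, ← neg_mem_iff]
        have : -(f * v (Sum.inr ())) = ∑ a, v (Sum.inl a) * F.gen a := by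
          linear_combination -h
        rw [this]
        exact F.mem_iff.2 ⟨_, rfl⟩
      obtain ⟨q, hq⟩ := G.mem_iff.1 hq
      obtain ⟨w, hw⟩ := (F.exact_zero (v ∘ Sum.inl + φ 0 *ᵥ q)).1 (by
        have h1 : ∑ a, (φ 0 *ᵥ q) a * F.gen a = f * v (Sum.inr ()) := by
          rw [← hq, hφ.sum_mulVec_mul_gen]
        simp only [Pi.add_apply, add_mul, Finset.sum_add_distrib, h1, Function.comp_apply]
        rw [mul_comm f]
        exact h)
      refine ⟨Sum.elim w q, ?_⟩
      change Matrix.fromBlocks _ _ _ _ *ᵥ Sum.elim w q = v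
      rw [Matrix.fromBlocks_mulVec]
      ext1 (a | a)
      · simp [hw, Matrix.neg_mulVec]
      · simp [← hq, Matrix.mulVec, dotProduct, mul_comm]
    · rintro ⟨w, rfl⟩
      change ∑ a : F.ι 0 ⊕ Unit, (Matrix.fromBlocks _ _ _ _ *ᵥ w) a *
        Sum.elim F.gen (fun _ => f) a = 0
      have h1 := (F.exact_zero _).2 ⟨w ∘ Sum.inl, rfl⟩
      have h2 := hφ.sum_mulVec_mul_gen (w ∘ Sum.inr)
      rw [Matrix.fromBlocks_mulVec]
      simp only [Fintype.sum_sum_type, Sum.elim_inl, Sum.elim_inr, Finset.univ_unique,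
        Finset.sum_singleton, Pi.add_apply, add_mul, Finset.sum_add_distrib, h1, zero_add,
        Matrix.neg_mulVec, Pi.neg_apply, neg_mul, Finset.sum_neg_distrib, h2, Matrix.zero_mulVec]
      simp [Matrix.mulVec, dotProduct, mul_comm]
  exact_succ
    | 0 => hφ.fromBlocks_mulVec_eq_zero_iff fun y => by
        rw [← G.exact_zero]
        constructor
        · intro h
          have := congrFun h ()
          simpa [Matrix.mulVec, dotProduct, mul_comm] using this
        · intro h
          ext1
          rw [Pi.zero_apply, ← h]
          simp [Matrix.mulVec, dotProduct, mul_comm]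
    | t + 1 => hφ.fromBlocks_mulVec_eq_zero_iff fun y => by
        rw [← G.exact_succ, Matrix.neg_mulVec, neg_eq_zero]
  minimal := by
    -- By `hdeg` every nonzero entry of `φ` has positive degree, so no cancellation occurs in the
    -- cone.
    have hneg : ∀ t a b, -φ t a b ∈ idealOfVars σ K := fun t a b => by
      refine neg_mem (mem_idealOfVars_iff_constantCoeff.2 ?_)
      by_contra h0
      have h := hφ.homogeneous t a b 0 (mem_support_iff.2 h0)
      have := hdeg t a b
      rw [map_zero] at h
      omega
    rintro (_ | t) (a | a) (b | b)
    · exact F.minimal 0 a b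
    · exact hneg 0 a b
    · exact zero_mem _
    · refine mem_idealOfVars_iff_constantCoeff.2 ?_
      by_contra h0
      have h := IsHomogeneous.degree_eq (G.gen_homogeneous b) (mem_support_iff.2 h0)
      have := hpos b
      rw [map_zero] at h
      omega
    · exact F.minimal (t + 1) a b
    · exact hneg (t + 1) a b
    · exact zero_mem _
    · exact neg_mem (G.minimal t a b)

theorem deg_eq_of_betti {F : MinimalGradedFreeResolution I} {t d : ℕ}
    (h : ∀ d', d' ≠ d → F.betti t d' = 0) (a : F.ι t) : F.deg t a = d := by
  by_contra hne
  have := h _ hne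
  rw [betti, Finset.card_eq_zero] at this
  exact Finset.notMem_empty a (this ▸ Finset.mem_filter.2 ⟨Finset.mem_univ a, rfl⟩)

/-- Adding a form `f` of degree `e` to `I`, when `(I : f)` has a linear resolution with the Betti
numbers of an ideal generated by `q` variables. -/
theorem exists_sup_span_singleton (F : MinimalGradedFreeResolution I)
    (G : MinimalGradedFreeResolution Q) {f : MvPolynomial σ K} {e q : ℕ} (hf : f.IsHomogeneous e)
    (hQ : ∀ p, p ∈ Q ↔ f * p ∈ I)
    (hG : ∀ t d, G.betti t d = if d = t + 1 then q.choose (t + 1) else 0)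
    (hF : ∀ t d, F.betti t d ≠ 0 → d < t + 1 + e) :
    ∃ C : MinimalGradedFreeResolution (I ⊔ Ideal.span {f}), ∀ t d,
      C.betti t d = F.betti t d + if d = t + e then q.choose t else 0 := by
  have hGdeg : ∀ t b, G.deg t b = t + 1 := fun t b =>
    deg_eq_of_betti (fun d' hd' => by rw [hG, if_neg hd']) b
  have hFdeg : ∀ t a, F.deg t a < t + 1 + e := fun t a =>
    hF t _ (Finset.card_ne_zero.2 ⟨a, Finset.mem_filter.2 ⟨Finset.mem_univ a, rfl⟩⟩)
  obtain ⟨φ, hφ⟩ := exists_isLift G F hf fun p hp => (hQ p).1 hp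
  refine ⟨mappingCone F G hf hQ hφ (fun t a b => by rw [hGdeg]; exact hFdeg t a)
    (fun b => by rw [hGdeg]; omega), fun t d => ?_⟩
  cases t with
  | zero =>
    change (Finset.univ.filter fun a : F.ι 0 ⊕ Unit => Sum.elim (F.deg 0) (fun _ => e) a = d).card
      = _
    rw [betti, Finset.card_filter, Finset.card_filter, Fintype.sum_sum_type]
    simp only [Sum.elim_inl, Sum.elim_inr, Finset.univ_unique, Finset.sum_singleton, zero_add,
      Nat.choose_zero_right, eq_comm (a := d)]
    congr
  | succ t =>
    change (Finset.univ.filter fun a : F.ι (t + 1) ⊕ G.ι t =>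
      Sum.elim (F.deg (t + 1)) (fun b => G.deg t b + e) a = d).card = _
    have h := hG t (t + 1)
    rw [if_pos rfl, betti, Finset.card_filter] at h
    simp only [hGdeg, if_true] at h
    rw [betti, Finset.card_filter, Finset.card_filter, Fintype.sum_sum_type]
    simp only [Sum.elim_inl, Sum.elim_inr, hGdeg]
    congr 1
    simp only [eq_comm (a := d)]
    split_ifs with hd
    · exact h
    · simp

theorem exists_bot (σ K : Type*) [Field K] :
    ∃ F : MinimalGradedFreeResolution (⊥ : Ideal (MvPolynomial σ K)), ∀ t d, F.betti t d = 0 :=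
  ⟨{  ι := fun _ => Empty
      deg := fun _ a => a.elim
      gen := fun a => a.elim
      diff := fun _ a => a.elim
      gen_homogeneous := fun a => a.elim
      diff_homogeneous := fun _ a => a.elim
      span_gen := by simp
      exact_zero := fun v => ⟨fun _ => ⟨0, Subsingleton.elim _ _⟩, fun _ => by simp⟩
      exact_succ := fun _ v =>
        ⟨fun _ => ⟨0, Subsingleton.elim _ _⟩, fun _ => Subsingleton.elim _ _⟩
      minimal := fun _ a => a.elim }, fun t d => by
    rw [betti, Finset.card_eq_zero]
    exact Finset.filter_eq_empty_iff.2 fun a => a.elim⟩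

/-- The Koszul resolution of an ideal generated by variables. -/
theorem exists_span_X_image (K : Type*) [Field K] (s : Finset σ) :
    ∃ F : MinimalGradedFreeResolution (Ideal.span (X '' (s : Set σ)) : Ideal (MvPolynomial σ K)),
      ∀ t d, F.betti t d = if d = t + 1 then s.card.choose (t + 1) else 0 := by
  classical
  induction s using Finset.induction_on with
  | empty =>
    rw [Finset.coe_empty, Set.image_empty, Ideal.span_empty]
    obtain ⟨F, hF⟩ := exists_bot σ K
    exact ⟨F, fun t d => by simp [hF]⟩
  | insert x s hx ih =>
    obtain ⟨F, hF⟩ := ih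
    -- A variable outside `s` is a nonzerodivisor modulo the ideal of `s`, so the colon ideal is
    -- that ideal itself and the same resolution serves twice. The Betti numbers then obey Pascal's
    -- rule.
    obtain ⟨C, hC⟩ := exists_sup_span_singleton F F (isHomogeneous_X K x) (fun p => by
      rw [mem_ideal_span_X_image, mem_ideal_span_X_image, support_X_mul]
      simp only [Finset.mem_map, addLeftEmbedding_apply]
      constructor
      · rintro h _ ⟨u, hu, rfl⟩
        obtain ⟨i, hi, hui⟩ := h u hu
        exact ⟨i, hi, by simp [hui]⟩
      · intro h u hu
        obtain ⟨i, hi, hui⟩ := h _ ⟨u, hu, rfl⟩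
        refine ⟨i, hi, ?_⟩
        have : x ≠ i := by
          rintro rfl
          exact hx hi
        simpa [Finsupp.single_apply, this] using hui) hF (fun t d hd => by
          rw [hF] at hd
          have := (ite_ne_right_iff.1 hd).1
          omega)
    have hI : Ideal.span (X '' (s : Set σ)) ⊔ Ideal.span {X x} =
        (Ideal.span (X '' ((insert x s : Finset σ) : Set σ)) : Ideal (MvPolynomial σ K)) := by
      rw [Finset.coe_insert, Set.image_insert_eq, Ideal.span_insert, sup_comm]
    rw [← hI]
    refine ⟨C, fun t d => ?_⟩
    rw [hC, hF, Finset.card_insert_of_notMem hx]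
    split_ifs
    · rw [Nat.choose_succ_succ, add_comm]
    · rfl

/-- Adding a block of monomials with linear quotients. -/
theorem exists_linearQuotients {ι : Type*} [LinearOrder ι] (S : Set (σ →₀ ℕ))
    (F : MinimalGradedFreeResolution
      (Ideal.span ((fun u => monomial u (1 : K)) '' S)))
    (T : Finset ι) (g : ι → σ →₀ ℕ) (v : ι → Finset σ) (e : ℕ)
    (hg : ∀ k ∈ T, (g k).degree = e)
    (hF : ∀ t d, F.betti t d ≠ 0 → d < t + 1 + e)
    (hmem : ∀ k ∈ T, ∀ x ∈ v k,
      ∃ s, (s ∈ S ∨ ∃ k' ∈ T, k' < k ∧ g k' = s) ∧ s ≤ g k + Finsupp.single x 1)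
    (hS : ∀ k ∈ T, ∀ s ∈ S, ∃ x ∈ v k, g k x < s x)
    (hT : ∀ k ∈ T, ∀ k' ∈ T, k' < k → ∃ x ∈ v k, g k x < g k' x) :
    ∃ C : MinimalGradedFreeResolution
      (Ideal.span ((fun u => monomial u (1 : K)) '' (S ∪ g '' T))), ∀ t d,
      C.betti t d = F.betti t d + if d = t + e then ∑ k ∈ T, (v k).card.choose t else 0 := by
  classical
  -- The greatest index is adjoined last, so everything already present precedes it.
  induction T using Finset.induction_on_max with
  | empty =>
    rw [Finset.coe_empty, Set.image_empty, Set.union_empty]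
    exact ⟨F, fun t d => by simp⟩
  | insert k T hk ih =>
    have hkT : k ∉ T := fun h => lt_irrefl _ (hk k h)
    have hsub : ∀ {k'}, k' ∈ T → k' ∈ insert k T := Finset.mem_insert_of_mem
    have hkk := Finset.mem_insert_self k T
    obtain ⟨C, hC⟩ := ih (fun k' h => hg k' (hsub h)) (fun k' h x hx => by
        obtain ⟨s, hs | ⟨l, hl, hlk, rfl⟩, hle⟩ := hmem k' (hsub h) x hx
        · exact ⟨s, Or.inl hs, hle⟩
        · refine ⟨_, Or.inr ⟨l, ?_, hlk, rfl⟩, hle⟩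
          exact (Finset.mem_insert.1 hl).resolve_left ((hlk.trans (hk k' h)).ne))
      (fun k' h => hS k' (hsub h)) (fun k' h l hl => hT k' (hsub h) l (hsub hl))
    obtain ⟨G, hG⟩ := exists_span_X_image K (v k)
    obtain ⟨D, hD⟩ := exists_sup_span_singleton C G (f := monomial (g k) 1)
      -- The colon ideal is exactly the ideal of `v k`: `hmem` puts each of these variables in it,
      -- while `hS` and `hT` say that every earlier generator exceeds `g k` in the exponent of one
      -- of them.
      (isHomogeneous_monomial 1 (hg k hkk)) (fun p => by
        rw [mem_ideal_span_X_image, mem_ideal_span_monomial_image]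
        constructor
        · intro h u hu
          obtain ⟨w, hw, rfl⟩ : ∃ w ∈ p.support, g k + w = u := by
            have := support_mul _ _ hu
            obtain ⟨a, ha, w, hw, rfl⟩ := Finset.mem_add.1 this
            have := support_monomial_subset ha
            rw [Finset.mem_singleton] at this
            exact ⟨w, hw, by rw [this]⟩
          obtain ⟨x, hx, hwx⟩ := h w hw
          obtain ⟨s, hs, hle⟩ := hmem k hkk x hx
          refine ⟨s, ?_, hle.trans ?_⟩
          · rcases hs with hs | ⟨l, hl, hlk, rfl⟩
            · exact Or.inl hs
            · exact Or.inr ⟨l, (Finset.mem_insert.1 hl).resolve_left hlk.ne, rfl⟩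
          · gcongr
            rw [Finsupp.single_le_iff]
            omega
        · intro h u hu
          obtain ⟨s, hs, hle⟩ := h (g k + u) (by
            rw [mem_support_iff, coeff_monomial_mul, one_mul]
            exact mem_support_iff.1 hu)
          obtain ⟨x, hx, hlt⟩ : ∃ x ∈ v k, g k x < s x := by
            rcases hs with hs | ⟨l, hl, rfl⟩
            · exact hS k hkk s hs
            · exact hT k hkk l (hsub hl) (hk l hl)
          refine ⟨x, hx, ?_⟩
          have := hle x
          rw [Finsupp.add_apply] at this
          omega) hG (fun t d hd => by
        rw [hC] at hd
        by_cases h : F.betti t d = 0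
        · rw [h, zero_add] at hd
          have := (ite_ne_right_iff.1 hd).1
          omega
        · exact hF t d h)
    have hI : Ideal.span ((fun u => monomial u (1 : K)) '' (S ∪ g '' T)) ⊔
          Ideal.span {monomial (g k) 1} =
        Ideal.span ((fun u => monomial u (1 : K)) '' (S ∪ g '' (insert k T : Finset ι))) := by
      rw [Finset.coe_insert, Set.image_insert_eq, Set.union_insert, Set.image_insert_eq,
        Ideal.span_insert, sup_comm]
    rw [← hI]
    refine ⟨D, fun t d => ?_⟩
    rw [hD, hC, Finset.sum_insert hkT]
    split_ifs <;> omega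

end MinimalGradedFreeResolution

/-! ### Exponent vectors and the lexicographic order -/

open MvPolynomial

open scoped MonomialOrder

/-- The exponent vector of `x_v`. -/
noncomputable def xExp {V : Type*} (v : V) : EdgeVar V →₀ ℕ := Finsupp.single (Sum.inlₗ v) 1

/-- The exponent vector of `y_v`. -/
noncomputable def yExp {V : Type*} (v : V) : EdgeVar V →₀ ℕ := Finsupp.single (Sum.inrₗ v) 1

section exponents

variable {V : Type*} [DecidableEq V] (v w : V)

@[simp] theorem xExp_inlₗ : xExp v (Sum.inlₗ w) = if v = w then 1 else 0 := by
  classical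
  rw [xExp, Finsupp.single_apply]
  exact if_congr (Sum.inl_injective.eq_iff (a := v) (b := w)) rfl rfl

@[simp] theorem xExp_inrₗ : xExp v (Sum.inrₗ w) = 0 := by
  classical
  rw [xExp, Finsupp.single_apply]
  exact if_neg (Sum.inl_ne_inr (a := v) (b := w))

@[simp] theorem yExp_inrₗ : yExp v (Sum.inrₗ w) = if v = w then 1 else 0 := by
  classical
  rw [yExp, Finsupp.single_apply]
  exact if_congr (Sum.inr_injective.eq_iff (a := v) (b := w)) rfl rfl

@[simp] theorem yExp_inlₗ : yExp v (Sum.inlₗ w) = 0 := by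
  classical
  rw [yExp, Finsupp.single_apply]
  exact if_neg (Sum.inr_ne_inl (a := w) (b := v))

end exponents

@[elab_as_elim]
theorem EdgeVar.cases {V : Type*} {P : EdgeVar V → Prop} (s : EdgeVar V)
    (x : ∀ v, P (Sum.inlₗ v)) (y : ∀ v, P (Sum.inrₗ v)) : P s :=
  match s with
  | .inl v => x v
  | .inr v => y v

theorem edgeLex_lt_iff {N : ℕ} {a b : EdgeVar (Fin N) →₀ ℕ} :
    a ≺[edgeLex N] b ↔ ∃ s, (∀ r < s, a r = b r) ∧ a s < b s :=
  Iff.rfl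

/-- The first variable at which the exponents differ is `x_i`. -/
theorem edgeLex_binomial {N : ℕ} {i j : Fin N} (hij : i < j) (w : EdgeVar (Fin N) →₀ ℕ) :
    w + (xExp j + yExp i) ≺[edgeLex N] w + (xExp i + yExp j) := by
  rw [edgeLex_lt_iff]
  refine ⟨Sum.inlₗ i, fun r => ?_, ?_⟩
  · refine EdgeVar.cases r (fun v hv => ?_) fun v hv => ?_
    · have hv := Sum.Lex.inl_lt_inl_iff.1 hv
      simp [hv.ne', (hv.trans hij).ne']
    · exact absurd hv Sum.Lex.not_inr_lt_inl
  · simp [hij.ne']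

theorem monomial_mul_binomial {K V : Type*} [Field K] (w : EdgeVar V →₀ ℕ) (i j : V) :
    monomial w (1 : K) * (xVar K i * yVar K j - xVar K j * yVar K i) =
      monomial (w + (xExp i + yExp j)) 1 - monomial (w + (xExp j + yExp i)) 1 := by
  simp only [xVar, yVar, X, monomial_mul, mul_sub, mul_one]
  rfl

theorem monomial_mem_initialIdeal {σ K : Type*} [Field K] {ord : MonomialOrder σ}
    {J : Ideal (MvPolynomial σ K)} {a b : σ →₀ ℕ} (hab : b ≺[ord] a)
    (h : monomial a (1 : K) - monomial b 1 ∈ J) : monomial a (1 : K) ∈ initialIdeal ord J := by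
  classical
  refine Ideal.subset_span ⟨_, h, ?_⟩
  have hlt : ord.degree (monomial b (1 : K)) ≺[ord] ord.degree (monomial a (1 : K)) := by
    rwa [ord.degree_monomial, ord.degree_monomial, if_neg one_ne_zero, if_neg one_ne_zero]
  rw [MonomialOrder.leadingTerm, ord.degree_sub_of_lt hlt, ord.leadingCoeff_sub_of_lt hlt,
    ord.leadingCoeff_monomial, ord.degree_monomial, if_neg one_ne_zero]

/-! ### Which monomials can lead an element of a binomial edge ideal -/

/-- The multidegree of a monomial modulo the relations `x_i y_j = x_j y_i`. -/
def fiberDegree {V : Type*} [Fintype V] (u : EdgeVar V →₀ ℕ) : (V → ℕ) × ℕ :=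
  (fun v => u (Sum.inlₗ v) + u (Sum.inrₗ v), ∑ v, u (Sum.inlₗ v))

theorem fiberDegree_add {V : Type*} [Fintype V] (u w : EdgeVar V →₀ ℕ) :
    fiberDegree (u + w) = fiberDegree u + fiberDegree w := by
  simp only [fiberDegree, Finsupp.add_apply, Finset.sum_add_distrib]
  refine Prod.ext (funext fun v => ?_) rfl
  simp only [Prod.mk_add_mk, Pi.add_apply]
  omega

theorem fiberDegree_binomial {V : Type*} [Fintype V] (i j : V) :
    fiberDegree (xExp i + yExp j) = fiberDegree (xExp j + yExp i) := by
  classical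
  refine Prod.ext (funext fun v => ?_) ?_
  · simp [fiberDegree, add_comm]
  · simp [fiberDegree]

open Classical in
/-- The sum of the coefficients of `f` over a class of monomials. -/
noncomputable def fiberSum (K : Type*) [Field K] {V : Type*} [Fintype V] (c : (V → ℕ) × ℕ) :
    MvPolynomial (EdgeVar V) K →ₗ[K] K :=
  (basisMonomials (EdgeVar V) K).constr K fun u => if fiberDegree u = c then 1 else 0

open Classical in
theorem fiberSum_monomial {K V : Type*} [Field K] [Fintype V] (c : (V → ℕ) × ℕ)
    (u : EdgeVar V →₀ ℕ) (a : K) :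
    fiberSum K c (monomial u a) = if fiberDegree u = c then a else 0 := by
  have : monomial u a = a • basisMonomials (EdgeVar V) K u := by
    rw [coe_basisMonomials, smul_monomial, smul_eq_mul, mul_one]
  rw [this, map_smul, fiberSum, Module.Basis.constr_basis]
  simp

/-- The two terms of any monomial multiple of a generator lie in the same class with opposite
coefficients. -/
theorem fiberSum_eq_zero {K V : Type*} [Field K] [Fintype V] (G : SimpleGraph V)
    (c : (V → ℕ) × ℕ) {f : MvPolynomial (EdgeVar V) K} (hf : f ∈ binomialEdgeIdeal K G) :
    fiberSum K c f = 0 := by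
  classical
  -- The functional is only `K`-linear, so the induction over the ideal has to carry arbitrary
  -- multipliers.
  suffices h : ∀ p, fiberSum K c (p * f) = 0 by simpa using h 1
  refine Submodule.span_induction (p := fun f _ => ∀ p, fiberSum K c (p * f) = 0) ?_ ?_ ?_ ?_ hf
  · rintro _ ⟨i, j, -, rfl⟩ p
    induction p using MvPolynomial.induction_on' with
    | monomial u a =>
      have : monomial u a = C a * monomial u 1 := by rw [C_mul_monomial, mul_one]
      rw [this, mul_assoc, monomial_mul_binomial, ← smul_eq_C_mul, map_smul, map_sub,
        fiberSum_monomial, fiberSum_monomial, fiberDegree_add u, fiberDegree_add u,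
        fiberDegree_binomial, sub_self, smul_zero]
    | add p q hp hq => rw [add_mul, map_add, hp, hq, add_zero]
  · simp
  · intro f g _ _ hf hg p
    rw [mul_add, map_add, hf, hg, add_zero]
  · intro a f _ hf p
    rw [smul_eq_mul, ← mul_assoc]
    exact hf _

/-- A monomial with no factor `x_i y_j`, `i < j`, is lex-smallest in its class. If `w` first drops
below `u` at `x_i`, then `u` has no `y_j` for `j > i`, hence already the largest possible
`x_j`-exponents there; `w` cannot recover the missing `x`-degree. A first difference at some `y_i`
contradicts the vertex degree at `i`. -/
theorem eq_of_fiberDegree_eq {N : ℕ} {u w : EdgeVar (Fin N) →₀ ℕ}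
    (hu : ∀ i j, i < j → u (Sum.inlₗ i) ≠ 0 → u (Sum.inrₗ j) = 0)
    (hw : w ≼[edgeLex N] u) (h : fiberDegree w = fiberDegree u) : w = u := by
  by_contra hne
  have hlt : w ≺[edgeLex N] u := lt_of_le_of_ne hw fun h => hne ((edgeLex N).toSyn.injective h)
  obtain ⟨s, hs, hlt⟩ := edgeLex_lt_iff.1 hlt
  have h1 : ∀ v, w (Sum.inlₗ v) + w (Sum.inrₗ v) = u (Sum.inlₗ v) + u (Sum.inrₗ v) := fun v =>
    congrFun (congrArg Prod.fst h) v
  have h2 : ∑ v, w (Sum.inlₗ v) = ∑ v, u (Sum.inlₗ v) := congrArg Prod.snd h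
  revert hs hlt
  refine EdgeVar.cases s (fun i hs hlt => ?_) fun i hs hlt => ?_
  · refine absurd h2 (Finset.sum_lt_sum (fun j _ => ?_) ⟨i, Finset.mem_univ i, hlt⟩).ne
    rcases lt_trichotomy j i with hj | rfl | hj
    · exact (hs _ (Sum.Lex.inl_lt_inl_iff.2 hj)).le
    · exact hlt.le
    · have := h1 j
      have := hu i j hj (by omega)
      omega
  · have := h1 i
    have := hs (Sum.inlₗ i) (Sum.Lex.inl_lt_inr i i)
    omega

/-- The leading monomial of an element of a binomial edge ideal is divisible by some `x_i y_j`
with `i < j`. -/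
theorem exists_lt_of_mem_binomialEdgeIdeal {K : Type*} [Field K] {N : ℕ}
    (G : SimpleGraph (Fin N)) {f : MvPolynomial (EdgeVar (Fin N)) K}
    (hf : f ∈ binomialEdgeIdeal K G) (h0 : f ≠ 0) :
    ∃ i j, i < j ∧ (edgeLex N).degree f (Sum.inlₗ i) ≠ 0 ∧
      (edgeLex N).degree f (Sum.inrₗ j) ≠ 0 := by
  classical
  by_contra! hcon
  refine (edgeLex N).coeff_degree_ne_zero_iff.2 h0 ?_
  have h := fiberSum_eq_zero G (fiberDegree ((edgeLex N).degree f)) hf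
  have hsum : fiberSum K (fiberDegree ((edgeLex N).degree f)) f = ∑ u ∈ f.support,
      fiberSum K (fiberDegree ((edgeLex N).degree f)) (monomial u (f.coeff u)) := by
    rw [← map_sum, ← f.as_sum]
  -- The leading monomial is assumed minimal in its class, so no other term of `f` shares that class
  -- and the class sum is the leading coefficient.
  rw [← h, hsum, Finset.sum_eq_single ((edgeLex N).degree f)]
  · rw [fiberSum_monomial, if_pos rfl]
  · intro w hw hne
    rw [fiberSum_monomial, if_neg fun hc => hne ?_]
    exact eq_of_fiberDegree_eq hcon ((edgeLex N).le_degree hw) hc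
  · intro hn
    exact absurd ((edgeLex N).degree_mem_support h0) hn

/-! ### Generators of the initial ideal for `K_{m,n}` -/

theorem bipartiteGraph_adj {m n : ℕ} {i j : Fin (m + n)} :
    (bipartiteGraph m n).Adj i j ↔ (i.1 < m ∧ m ≤ j.1) ∨ (j.1 < m ∧ m ≤ i.1) := by
  obtain ⟨i, rfl⟩ := finSumFinEquiv.surjective i
  obtain ⟨j, rfl⟩ := finSumFinEquiv.surjective j
  have : (bipartiteGraph m n).Adj (finSumFinEquiv i) (finSumFinEquiv j) ↔
      (completeBipartiteGraph (Fin m) (Fin n)).Adj i j :=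
    SimpleGraph.map_adj_apply (f := finSumFinEquiv.toEmbedding)
  rw [this]
  rcases i with i | i <;> rcases j with j | j <;> simp

/-- The minimal generators of the initial ideal of the binomial edge ideal of `K_{m,n}`. -/
def initialExponents (m n : ℕ) : Set (EdgeVar (Fin (m + n)) →₀ ℕ) :=
  {u | (∃ i j, i.1 < m ∧ m ≤ j.1 ∧ xExp i + yExp j = u) ∨
    (∃ b i j, i < j ∧ j.1 < m ∧ m ≤ b.1 ∧ xExp b + (xExp i + yExp j) = u) ∨
    ∃ a i j, i < j ∧ a.1 < m ∧ m ≤ i.1 ∧ yExp a + (xExp i + yExp j) = u}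

theorem binomial_mem {K : Type*} [Field K] {m n : ℕ} {i j : Fin (m + n)}
    (hi : i.1 < m) (hj : m ≤ j.1) :
    xVar K i * yVar K j - xVar K j * yVar K i ∈ binomialEdgeIdeal K (bipartiteGraph m n) :=
  Ideal.subset_span ⟨i, j, bipartiteGraph_adj.2 (Or.inl ⟨hi, hj⟩), rfl⟩

theorem monomial_mem_initialIdeal_of_mem {K : Type*} [Field K] {m n : ℕ}
    {u : EdgeVar (Fin (m + n)) →₀ ℕ} (hu : u ∈ initialExponents m n) :
    monomial u (1 : K) ∈
      initialIdeal (edgeLex (m + n)) (binomialEdgeIdeal K (bipartiteGraph m n)) := by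
  have key : ∀ (w) {i j : Fin (m + n)}, i < j →
      monomial w 1 * (xVar K i * yVar K j - xVar K j * yVar K i) ∈
        binomialEdgeIdeal K (bipartiteGraph m n) → monomial (w + (xExp i + yExp j)) (1 : K) ∈
      initialIdeal (edgeLex (m + n)) (binomialEdgeIdeal K (bipartiteGraph m n)) := by
    intro w i j hij h
    exact monomial_mem_initialIdeal (edgeLex_binomial hij w) (by rwa [← monomial_mul_binomial])
  rcases hu with ⟨i, j, hi, hj, rfl⟩ | ⟨b, i, j, hij, hj, hb, rfl⟩ | ⟨a, i, j, hij, ha, hi, rfl⟩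
  · rw [← zero_add (xExp i + yExp j)]
    exact key 0 (Fin.lt_def.2 (by omega)) (Ideal.mul_mem_left _ _ (binomial_mem hi hj))
  · refine key _ hij ?_
    -- With `[i, j] = x_i y_j - x_j y_i`, the identity used is `x_b [i, j] = x_j [i, b] - x_i [j,
    -- b]`.
    have h1 := Ideal.mul_mem_left _ (xVar K j) (binomial_mem (K := K) (i := i) (Nat.lt_trans hij hj) hb)
    have h2 := Ideal.mul_mem_left _ (xVar K i) (binomial_mem (K := K) hj hb)
    convert sub_mem h1 h2 using 1
    change xVar K b * _ = _
    ring
  · refine key _ hij ?_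
    -- Likewise `y_a [i, j] = y_i [a, j] - y_j [a, i]`.
    have h1 := Ideal.mul_mem_left _ (yVar K i) (binomial_mem (K := K) ha (hi.trans hij.le))
    have h2 := Ideal.mul_mem_left _ (yVar K j) (binomial_mem (K := K) ha hi)
    convert sub_mem h1 h2 using 1
    change yVar K a * _ = _
    ring

/-- If `i` and `j` lie on opposite sides, `x_i y_j` is a generator. If both are on the left, a right
vertex `b` supplies either `y_b`, giving `x_i y_b`, or `x_b`, giving `x_b x_i y_j`. The case of both
on the right is symmetric. -/
theorem exists_mem_initialExponents_le {m n : ℕ} {u : EdgeVar (Fin (m + n)) →₀ ℕ}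
    (hA : ∃ a : Fin (m + n), a.1 < m ∧ (u (Sum.inlₗ a) ≠ 0 ∨ u (Sum.inrₗ a) ≠ 0))
    (hB : ∃ b : Fin (m + n), m ≤ b.1 ∧ (u (Sum.inlₗ b) ≠ 0 ∨ u (Sum.inrₗ b) ≠ 0))
    {i j : Fin (m + n)} (hij : i < j) (hi : u (Sum.inlₗ i) ≠ 0) (hj : u (Sum.inrₗ j) ≠ 0) :
    ∃ s ∈ initialExponents m n, s ≤ u := by
  have h2 : ∀ {i j : Fin (m + n)}, u (Sum.inlₗ i) ≠ 0 → u (Sum.inrₗ j) ≠ 0 →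
      xExp i + yExp j ≤ u := by
    intro i j hi hj s
    refine EdgeVar.cases s (fun v => ?_) fun v => ?_
    · simp only [Finsupp.add_apply, xExp_inlₗ, yExp_inlₗ]
      split_ifs with h
      · subst h; omega
      · omega
    · simp only [Finsupp.add_apply, xExp_inrₗ, yExp_inrₗ]
      split_ifs with h
      · subst h; omega
      · omega
  obtain ⟨a, ha, hua⟩ := hA
  obtain ⟨b, hb, hub⟩ := hB
  rcases lt_or_ge i.1 m with him | him
  · rcases le_or_gt m j.1 with hjm | hjm
    · exact ⟨_, Or.inl ⟨i, j, him, hjm, rfl⟩, h2 hi hj⟩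
    · rcases hub with hub | hub
      · refine ⟨_, Or.inr (Or.inl ⟨b, i, j, hij, hjm, hb, rfl⟩), fun s => ?_⟩
        -- Distinctness keeps the generator squarefree, so nonvanishing of the exponents of `u` is
        -- enough for divisibility.
        have hbi : b ≠ i := by rintro rfl; omega
        refine EdgeVar.cases s (fun v => ?_) fun v => ?_
        · simp only [Finsupp.add_apply, xExp_inlₗ, yExp_inlₗ]
          split_ifs <;> subst_vars <;> omega
        · simp only [Finsupp.add_apply, xExp_inrₗ, yExp_inrₗ]
          split_ifs <;> subst_vars <;> omega
      · exact ⟨_, Or.inl ⟨i, b, him, hb, rfl⟩, h2 hi hub⟩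
  · have hjm : m ≤ j.1 := him.trans hij.le
    rcases hua with hua | hua
    · exact ⟨_, Or.inl ⟨a, j, ha, hjm, rfl⟩, h2 hua hj⟩
    · refine ⟨_, Or.inr (Or.inr ⟨a, i, j, hij, ha, him, rfl⟩), fun s => ?_⟩
      have haj : a ≠ j := by rintro rfl; omega
      refine EdgeVar.cases s (fun v => ?_) fun v => ?_
      · simp only [Finsupp.add_apply, xExp_inlₗ, yExp_inlₗ]
        split_ifs <;> subst_vars <;> omega
      · simp only [Finsupp.add_apply, xExp_inrₗ, yExp_inrₗ]
        split_ifs <;> subst_vars <;> omega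

/-- `P` is a vertex cover, so each edge binomial lies in the ideal generated by the variables at
vertices of `P`. Each side of `K_{m,n}` is such a cover. -/
theorem exists_ne_zero_of_mem_binomialEdgeIdeal {K V : Type*} [Field K] {G : SimpleGraph V}
    {P : V → Prop} (hP : ∀ i j, G.Adj i j → P i ∨ P j) {f : MvPolynomial (EdgeVar V) K}
    (hf : f ∈ binomialEdgeIdeal K G) {u : EdgeVar V →₀ ℕ} (hu : u ∈ f.support) :
    ∃ a, P a ∧ (u (Sum.inlₗ a) ≠ 0 ∨ u (Sum.inrₗ a) ≠ 0) := by
  have hle : binomialEdgeIdeal K G ≤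
      Ideal.span (X '' {s | ∃ a, P a ∧ (s = Sum.inlₗ a ∨ s = Sum.inrₗ a)}) := by
    refine Ideal.span_le.2 ?_
    rintro _ ⟨i, j, hij, rfl⟩
    rcases hP i j hij with h | h
    · exact sub_mem (Ideal.mul_mem_right _ _ (Ideal.subset_span ⟨_, ⟨i, h, Or.inl rfl⟩, rfl⟩))
        (Ideal.mul_mem_left _ _ (Ideal.subset_span ⟨_, ⟨i, h, Or.inr rfl⟩, rfl⟩))
    · exact sub_mem (Ideal.mul_mem_left _ _ (Ideal.subset_span ⟨_, ⟨j, h, Or.inr rfl⟩, rfl⟩))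
        (Ideal.mul_mem_right _ _ (Ideal.subset_span ⟨_, ⟨j, h, Or.inl rfl⟩, rfl⟩))
  obtain ⟨s, ⟨a, ha, rfl | rfl⟩, hs⟩ := mem_ideal_span_X_image.1 (hle hf) u hu
  · exact ⟨a, ha, Or.inl hs⟩
  · exact ⟨a, ha, Or.inr hs⟩

theorem initialIdeal_bipartiteGraph (K : Type*) [Field K] (m n : ℕ) :
    initialIdeal (edgeLex (m + n)) (binomialEdgeIdeal K (bipartiteGraph m n)) =
      Ideal.span ((fun u => monomial u (1 : K)) '' initialExponents m n) := by
  refine le_antisymm (Ideal.span_le.2 ?_) (Ideal.span_le.2 ?_)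
  · rintro _ ⟨f, hf, rfl⟩
    by_cases h0 : f = 0
    · simp [h0]
    refine mem_ideal_span_monomial_image.2 fun u hu => ?_
    have hu := support_monomial_subset hu
    rw [Finset.mem_singleton] at hu
    subst hu
    have hsupp := (edgeLex (m + n)).degree_mem_support h0
    obtain ⟨i, j, hij, hi, hj⟩ := exists_lt_of_mem_binomialEdgeIdeal _ hf h0
    refine exists_mem_initialExponents_le
      (exists_ne_zero_of_mem_binomialEdgeIdeal (P := fun a => a.1 < m) (fun i j h => ?_) hf hsupp)
      (exists_ne_zero_of_mem_binomialEdgeIdeal (P := fun a => m ≤ a.1) (fun i j h => ?_) hf hsupp)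
      hij hi hj
    · exact (bipartiteGraph_adj.1 h).imp (fun h => h.1) fun h => h.1
    · exact (bipartiteGraph_adj.1 h).symm.imp (fun h => h.2) fun h => h.2
  · rintro _ ⟨u, hu, rfl⟩
    exact monomial_mem_initialIdeal_of_mem hu

/-! ### Indexing the generators and their colon ideals -/

/-- The set of variables `x_v`, `v ∈ s`, and `y_v`, `v ∈ t`. -/
def varSet {V : Type*} (s t : Finset V) : Finset (EdgeVar V) :=
  (s.disjSum t).map toLex.toEmbedding

theorem card_varSet {V : Type*} (s t : Finset V) : (varSet s t).card = s.card + t.card := by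
  rw [varSet, Finset.card_map, Finset.card_disjSum]

theorem forall_mem_varSet {V : Type*} {s t : Finset V} {P : EdgeVar V → Prop} :
    (∀ x ∈ varSet s t, P x) ↔ (∀ v ∈ s, P (Sum.inlₗ v)) ∧ ∀ v ∈ t, P (Sum.inrₗ v) := by
  simp only [varSet, Finset.forall_mem_map, Finset.mem_disjSum, or_imp, forall_and]
  simp

theorem exists_mem_varSet {V : Type*} {s t : Finset V} {P : EdgeVar V → Prop} :
    (∃ x ∈ varSet s t, P x) ↔ (∃ v ∈ s, P (Sum.inlₗ v)) ∨ ∃ v ∈ t, P (Sum.inrₗ v) := by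
  have h := not_congr (forall_mem_varSet (s := s) (t := t) (P := fun x => ¬P x))
  push Not at h
  rw [h, or_iff_not_imp_left]
  push Not
  rfl

section

variable (m n : ℕ)

/-- The pairs `(i, j)` indexing the generators `x_i y_j`. -/
def pairs : Finset (Fin (m + n) ×ₗ Fin (m + n)) :=
  Finset.univ.filter fun p => (ofLex p).1.1 < m ∧ m ≤ (ofLex p).2.1

/-- The triples `(b, i, j)` indexing the generators `x_b x_i y_j`. -/
def leftTriples : Finset (Fin (m + n) ×ₗ Fin (m + n) ×ₗ Fin (m + n)) :=
  Finset.univ.filter fun p => (ofLex (ofLex p).2).1 < (ofLex (ofLex p).2).2 ∧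
    (ofLex (ofLex p).2).2.1 < m ∧ m ≤ (ofLex p).1.1

/-- The triples `(a, i, j)` indexing the generators `y_a x_i y_j`. -/
def rightTriples : Finset (Fin (m + n) ×ₗ Fin (m + n) ×ₗ Fin (m + n)) :=
  Finset.univ.filter fun p => (ofLex (ofLex p).2).1 < (ofLex (ofLex p).2).2 ∧
    (ofLex p).1.1 < m ∧ m ≤ (ofLex (ofLex p).2).1.1

/-- The exponent vector of `x_i y_j`. -/
noncomputable def pairExp {V : Type*} (p : V ×ₗ V) : EdgeVar V →₀ ℕ :=
  xExp (ofLex p).1 + yExp (ofLex p).2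

/-- The exponent vector of `x_b x_i y_j`. -/
noncomputable def leftExp {V : Type*} (p : V ×ₗ V ×ₗ V) : EdgeVar V →₀ ℕ :=
  xExp (ofLex p).1 + pairExp (ofLex p).2

/-- The exponent vector of `y_a x_i y_j`. -/
noncomputable def rightExp {V : Type*} (p : V ×ₗ V ×ₗ V) : EdgeVar V →₀ ℕ :=
  yExp (ofLex p).1 + pairExp (ofLex p).2

theorem initialExponents_eq :
    initialExponents m n = ∅ ∪ pairExp '' (pairs m n : Set (Fin (m + n) ×ₗ Fin (m + n))) ∪
      leftExp '' (leftTriples m n : Set (Fin (m + n) ×ₗ Fin (m + n) ×ₗ Fin (m + n))) ∪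
      rightExp '' (rightTriples m n : Set (Fin (m + n) ×ₗ Fin (m + n) ×ₗ Fin (m + n))) := by
  ext u
  simp [initialExponents, pairs, leftTriples, rightTriples, leftExp, rightExp, pairExp,
    Lex.exists, and_assoc, or_assoc]

@[simp] theorem degree_xExp {V : Type*} (v : V) : (xExp v).degree = 1 := by simp [xExp]

@[simp] theorem degree_yExp {V : Type*} (v : V) : (yExp v).degree = 1 := by simp [yExp]

/-- The vertex `m` of `K_{m,n}`. -/
def firstRight {m n : ℕ} (hn : 1 ≤ n) : Fin (m + n) := ⟨m, by omega⟩

variable {m n} (hn : 1 ≤ n)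

/-- The variables generating the colon ideal of a generator by the preceding ones. -/
def pairColon (p : Fin (m + n) ×ₗ Fin (m + n)) : Finset (EdgeVar (Fin (m + n))) :=
  varSet (Finset.Iio (ofLex p).1) (Finset.Ico (firstRight hn) (ofLex p).2)

/-- The variables generating the colon ideal of a generator by the preceding ones. -/
def leftColon (p : Fin (m + n) ×ₗ Fin (m + n) ×ₗ Fin (m + n)) :
    Finset (EdgeVar (Fin (m + n))) :=
  varSet (Finset.Iio (ofLex (ofLex p).2).1 ∪ Finset.Ico (firstRight hn) (ofLex p).1)
    (Finset.Ioo (ofLex (ofLex p).2).1 (ofLex (ofLex p).2).2 ∪ Finset.Ici (firstRight hn))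

/-- The variables generating the colon ideal of a generator by the preceding ones. -/
def rightColon (p : Fin (m + n) ×ₗ Fin (m + n) ×ₗ Fin (m + n)) :
    Finset (EdgeVar (Fin (m + n))) :=
  varSet (Finset.Iio (ofLex (ofLex p).2).1)
    (Finset.Iio (ofLex p).1 ∪ Finset.Ioo (ofLex (ofLex p).2).1 (ofLex (ofLex p).2).2)

end

/-! ### Linear quotients for the three blocks of generators -/

open MinimalGradedFreeResolution

/-- Lowering either index of `x_i y_j` within its side yields an earlier generator, at the cost of
one new variable. -/
theorem exists_pairs (K : Type*) [Field K] {m n : ℕ} (hn : 1 ≤ n) :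
    ∃ F : MinimalGradedFreeResolution (Ideal.span ((fun u => monomial u (1 : K)) ''
      (∅ ∪ pairExp '' (pairs m n : Set (Fin (m + n) ×ₗ Fin (m + n)))))), ∀ t d,
      F.betti t d =
        if d = t + 2 then ∑ k ∈ pairs m n, (pairColon hn k).card.choose t else 0 := by
  obtain ⟨F, hF⟩ : ∃ F : MinimalGradedFreeResolution (Ideal.span
      ((fun u => monomial u (1 : K)) '' (∅ : Set (EdgeVar (Fin (m + n)) →₀ ℕ)))),
      ∀ t d, F.betti t d = 0 := by
    rw [Set.image_empty, Ideal.span_empty]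
    exact exists_bot _ K
  refine Exists.imp (fun C hC t d => ?_) <| exists_linearQuotients ∅ F (pairs m n) pairExp (pairColon hn) 2
    (fun k _ => by simp [pairExp]) (fun t d h => absurd (hF t d) h) ?_ (by simp) ?_
  · rw [hC, hF, zero_add]
  · rw [Lex.forall]
    rintro ⟨i, j⟩ hk
    obtain ⟨hi, hj⟩ := (Finset.mem_filter.1 hk).2
    dsimp only [ofLex_toLex] at hi hj
    simp only [pairColon, forall_mem_varSet, Finset.mem_Iio, Finset.mem_Ico, ofLex_toLex]
    refine ⟨fun v hv => ⟨_, Or.inr ⟨toLex (v, j), ?_, ?_, rfl⟩, ?_⟩,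
      fun v hv => ⟨_, Or.inr ⟨toLex (i, v), ?_, ?_, rfl⟩, ?_⟩⟩
    · exact Finset.mem_filter.2 ⟨Finset.mem_univ _, Nat.lt_trans hv hi, hj⟩
    · exact Prod.Lex.toLex_lt_toLex.2 (Or.inl hv)
    · exact le_iff_exists_add.2 ⟨xExp i, by simp only [pairExp, xExp, ofLex_toLex]; abel⟩
    · exact Finset.mem_filter.2 ⟨Finset.mem_univ _, hi, hv.1⟩
    · exact Prod.Lex.toLex_lt_toLex.2 (Or.inr ⟨rfl, hv.2⟩)
    · exact le_iff_exists_add.2 ⟨yExp j, by simp only [pairExp, yExp, ofLex_toLex]; abel⟩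
  · simp only [Lex.forall]
    rintro ⟨i, j⟩ hk ⟨i', j'⟩ hk' hlt
    have hj' := (Finset.mem_filter.1 hk').2.2
    simp only [pairColon, exists_mem_varSet, Finset.mem_Iio, Finset.mem_Ico, ofLex_toLex, pairExp]
    rcases Prod.Lex.toLex_lt_toLex.1 hlt with h | ⟨rfl, h⟩
    · exact Or.inl ⟨i', h, by simp [h.ne']⟩
    · exact Or.inr ⟨j', ⟨hj', h⟩, by simp [show j ≠ j' from h.ne']⟩

/-- Multiplying `x_b x_i y_j` by any right `y_v` makes it divisible by the quadric `x_i y_v`; the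
remaining colon variables come from lowering `b`, `i` or `j` within the block, with `j` staying
above `i`. -/
theorem exists_leftTriples (K : Type*) [Field K] {m n : ℕ} (hn : 1 ≤ n) :
    ∃ F : MinimalGradedFreeResolution (Ideal.span ((fun u => monomial u (1 : K)) ''
      (∅ ∪ pairExp '' (pairs m n : Set (Fin (m + n) ×ₗ Fin (m + n))) ∪
      leftExp '' (leftTriples m n : Set (Fin (m + n) ×ₗ Fin (m + n) ×ₗ Fin (m + n)))))), ∀ t d,
      F.betti t d =
        (if d = t + 2 then ∑ k ∈ pairs m n, (pairColon hn k).card.choose t else 0) +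
        if d = t + 3 then ∑ k ∈ leftTriples m n, (leftColon hn k).card.choose t else 0 := by
  obtain ⟨F, hF⟩ := exists_pairs K (m := m) hn
  refine Exists.imp (fun C hC t d => ?_) <| exists_linearQuotients _ F (leftTriples m n) leftExp (leftColon hn) 3
    (fun k _ => by simp [leftExp, pairExp]) (fun t d h => by
      rw [hF] at h
      have := (ite_ne_right_iff.1 h).1
      omega) ?_ ?_ ?_
  · rw [hC, hF]
  · refine toLex.surjective.forall.2 (Prod.forall.2 fun b =>
      toLex.surjective.forall.2 (Prod.forall.2 fun i j hk => ?_))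
    obtain ⟨hij, hj, hb⟩ := (Finset.mem_filter.1 hk).2
    dsimp only [ofLex_toLex] at hij hj hb
    simp only [leftColon, forall_mem_varSet, Finset.mem_union, Finset.mem_Iio, Finset.mem_Ico,
      Finset.mem_Ioo, Finset.mem_Ici, ofLex_toLex]
    refine ⟨fun v hv => ?_, fun v hv => ?_⟩
    · rcases hv with hv | hv
      · refine ⟨_, Or.inr ⟨toLex (b, toLex (v, j)), ?_, ?_, rfl⟩, ?_⟩
        · exact Finset.mem_filter.2 ⟨Finset.mem_univ _, hv.trans hij, hj, hb⟩
        · exact Prod.Lex.toLex_lt_toLex.2 (Or.inr ⟨rfl, Prod.Lex.toLex_lt_toLex.2 (Or.inl hv)⟩)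
        · exact le_iff_exists_add.2
            ⟨xExp i, by simp only [leftExp, pairExp, xExp, ofLex_toLex]; abel⟩
      · refine ⟨_, Or.inr ⟨toLex (v, toLex (i, j)), ?_, ?_, rfl⟩, ?_⟩
        · exact Finset.mem_filter.2 ⟨Finset.mem_univ _, hij, hj, hv.1⟩
        · exact Prod.Lex.toLex_lt_toLex.2 (Or.inl hv.2)
        · exact le_iff_exists_add.2
            ⟨xExp b, by simp only [leftExp, pairExp, xExp, ofLex_toLex]; abel⟩
    · rcases hv with hv | hv
      · refine ⟨_, Or.inr ⟨toLex (b, toLex (i, v)), ?_, ?_, rfl⟩, ?_⟩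
        · exact Finset.mem_filter.2 ⟨Finset.mem_univ _, hv.1, Nat.lt_trans hv.2 hj, hb⟩
        · exact Prod.Lex.toLex_lt_toLex.2
            (Or.inr ⟨rfl, Prod.Lex.toLex_lt_toLex.2 (Or.inr ⟨rfl, hv.2⟩)⟩)
        · exact le_iff_exists_add.2
            ⟨yExp j, by simp only [leftExp, pairExp, yExp, ofLex_toLex]; abel⟩
      · refine ⟨_, Or.inl (Or.inr ⟨toLex (i, v), ?_, rfl⟩), ?_⟩
        · exact Finset.mem_filter.2 ⟨Finset.mem_univ _, Nat.lt_trans hij hj, hv⟩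
        · exact le_iff_exists_add.2 ⟨xExp b + yExp j,
            by simp only [leftExp, pairExp, yExp, ofLex_toLex]; abel⟩
  · simp only [Lex.forall, Prod.forall]
    rintro b i j hk _ (⟨⟨⟩⟩ | ⟨p, hp, rfl⟩)
    obtain ⟨hij, hj, hb⟩ := (Finset.mem_filter.1 hk).2
    dsimp only [ofLex_toLex] at hij hj hb
    have hp' := (Finset.mem_filter.1 hp).2.2
    rw [leftColon, exists_mem_varSet]
    refine Or.inr ⟨(ofLex p).2, Finset.mem_union_right _ (Finset.mem_Ici.2 hp'), ?_⟩
    have : j ≠ (ofLex p).2 := (show j < (ofLex p).2 from Nat.lt_of_lt_of_le hj hp').ne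
    simp [leftExp, pairExp, this]
  · simp only [Lex.forall, Prod.forall]
    rintro b i j hk b' i' j' hk' hlt
    obtain ⟨hij, hj, hb⟩ := (Finset.mem_filter.1 hk).2
    obtain ⟨hij', hj', hb'⟩ := (Finset.mem_filter.1 hk').2
    dsimp only [ofLex_toLex] at hij hj hb hij' hj' hb'
    have hne : ∀ {l r : Fin (m + n)}, m ≤ l.1 → r.1 < m → l ≠ r := by
      rintro l _ h1 h2 rfl
      omega
    simp only [leftColon, exists_mem_varSet, Finset.mem_union, Finset.mem_Iio, Finset.mem_Ico,
      Finset.mem_Ioo, Finset.mem_Ici, ofLex_toLex, leftExp, pairExp]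
    rcases Prod.Lex.toLex_lt_toLex.1 hlt with h | ⟨h, hlt⟩
    · exact Or.inl ⟨b', Or.inr ⟨hb', h⟩,
        by simp [show b ≠ b' from h.ne', (hne hb' (Nat.lt_trans hij hj)).symm]⟩
    obtain rfl : b' = b := h
    rcases Prod.Lex.toLex_lt_toLex.1 hlt with h | ⟨h, hlt⟩
    · exact Or.inl ⟨i', Or.inl h,
        by simp [show i ≠ i' from h.ne', hne hb (Nat.lt_trans hij' hj')]⟩
    obtain rfl : i' = i := h
    exact Or.inr ⟨j', Or.inl ⟨hij', hlt⟩, by simp [show j ≠ j' from hlt.ne']⟩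

/-- Here every left `x_v` is a colon variable, through the quadric `x_v y_j`. The other colon
variables come from lowering `a`, `i` or `j` within the block. -/
theorem exists_rightTriples (K : Type*) [Field K] {m n : ℕ} (hn : 1 ≤ n) :
    ∃ F : MinimalGradedFreeResolution (Ideal.span ((fun u => monomial u (1 : K)) ''
      initialExponents m n)), ∀ t d,
      F.betti t d =
        (if d = t + 2 then ∑ k ∈ pairs m n, (pairColon hn k).card.choose t else 0) +
        if d = t + 3 then ∑ k ∈ leftTriples m n, (leftColon hn k).card.choose t +
          ∑ k ∈ rightTriples m n, (rightColon k).card.choose t else 0 := by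
  rw [initialExponents_eq]
  obtain ⟨F, hF⟩ := exists_leftTriples K (m := m) hn
  refine Exists.imp (fun C hC t d => ?_) <| exists_linearQuotients _ F (rightTriples m n) rightExp rightColon 3
    (fun k _ => by simp [rightExp, pairExp]) (fun t d h => by
      rw [hF] at h
      by_contra hd
      rw [if_neg (by omega), if_neg (by omega)] at h
      exact h rfl) ?_ ?_ ?_
  · rw [hC, hF]
    split_ifs <;> omega
  · refine toLex.surjective.forall.2 (Prod.forall.2 fun a =>
      toLex.surjective.forall.2 (Prod.forall.2 fun i j hk => ?_))
    obtain ⟨hij, ha, hi⟩ := (Finset.mem_filter.1 hk).2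
    dsimp only [ofLex_toLex] at hij ha hi
    simp only [rightColon, forall_mem_varSet, Finset.mem_union, Finset.mem_Iio, Finset.mem_Ioo,
      ofLex_toLex]
    refine ⟨fun v hv => ?_, fun v hv => ?_⟩
    -- The range `v < i` mixes two sources: left vertices, handled by quadrics, and right vertices,
    -- handled by earlier cubics of this block.
    · rcases lt_or_ge v.1 m with hvm | hvm
      · refine ⟨_, Or.inl (Or.inl (Or.inr ⟨toLex (v, j), ?_, rfl⟩)), ?_⟩
        · exact Finset.mem_filter.2 ⟨Finset.mem_univ _, hvm, hi.trans hij.le⟩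
        · exact le_iff_exists_add.2 ⟨yExp a + xExp i,
            by simp only [rightExp, pairExp, xExp, ofLex_toLex]; abel⟩
      · refine ⟨_, Or.inr ⟨toLex (a, toLex (v, j)), ?_, ?_, rfl⟩, ?_⟩
        · exact Finset.mem_filter.2 ⟨Finset.mem_univ _, hv.trans hij, ha, hvm⟩
        · exact Prod.Lex.toLex_lt_toLex.2 (Or.inr ⟨rfl, Prod.Lex.toLex_lt_toLex.2 (Or.inl hv)⟩)
        · exact le_iff_exists_add.2
            ⟨xExp i, by simp only [rightExp, pairExp, xExp, ofLex_toLex]; abel⟩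
    · rcases hv with hv | hv
      · refine ⟨_, Or.inr ⟨toLex (v, toLex (i, j)), ?_, ?_, rfl⟩, ?_⟩
        · exact Finset.mem_filter.2 ⟨Finset.mem_univ _, hij, Nat.lt_trans hv ha, hi⟩
        · exact Prod.Lex.toLex_lt_toLex.2 (Or.inl hv)
        · exact le_iff_exists_add.2
            ⟨yExp a, by simp only [rightExp, pairExp, yExp, ofLex_toLex]; abel⟩
      · refine ⟨_, Or.inr ⟨toLex (a, toLex (i, v)), ?_, ?_, rfl⟩, ?_⟩
        · exact Finset.mem_filter.2 ⟨Finset.mem_univ _, hv.1, ha, hi⟩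
        · exact Prod.Lex.toLex_lt_toLex.2
            (Or.inr ⟨rfl, Prod.Lex.toLex_lt_toLex.2 (Or.inr ⟨rfl, hv.2⟩)⟩)
        · exact le_iff_exists_add.2
            ⟨yExp j, by simp only [rightExp, pairExp, yExp, ofLex_toLex]; abel⟩
  · simp only [Lex.forall, Prod.forall]
    rintro a i j hk s hs
    obtain ⟨hij, ha, hi⟩ := (Finset.mem_filter.1 hk).2
    dsimp only [ofLex_toLex] at hij ha hi
    -- Every generator of the first two blocks contains an `x` at a left vertex, whereas `y_a x_i
    -- y_j` contains none.
    obtain ⟨i', hi', hpos⟩ : ∃ i' : Fin (m + n), i'.1 < m ∧ 0 < s (Sum.inlₗ i') := by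
      rcases hs with (⟨⟨⟩⟩ | ⟨p, hp, rfl⟩) | ⟨p, hp, rfl⟩
      · exact ⟨_, (Finset.mem_filter.1 hp).2.1, by simp [pairExp]⟩
      · obtain ⟨h1, h2, -⟩ := (Finset.mem_filter.1 hp).2
        exact ⟨_, Nat.lt_trans h1 h2, by simp [leftExp, pairExp]⟩
    have hlt : i' < i := Nat.lt_of_lt_of_le hi' hi
    rw [rightColon, exists_mem_varSet]
    exact Or.inl ⟨i', Finset.mem_Iio.2 hlt, by simpa [rightExp, pairExp, hlt.ne'] using hpos⟩
  · simp only [Lex.forall, Prod.forall]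
    rintro a i j hk a' i' j' hk' hlt
    obtain ⟨hij, ha, hi⟩ := (Finset.mem_filter.1 hk).2
    obtain ⟨hij', ha', hi'⟩ := (Finset.mem_filter.1 hk').2
    dsimp only [ofLex_toLex] at hij ha hi hij' ha' hi'
    have hne : ∀ {l r : Fin (m + n)}, m ≤ l.1 → r.1 < m → l ≠ r := by
      rintro l _ h1 h2 rfl
      omega
    simp only [rightColon, exists_mem_varSet, Finset.mem_union, Finset.mem_Iio,
      Finset.mem_Ioo, ofLex_toLex, rightExp, pairExp]
    rcases Prod.Lex.toLex_lt_toLex.1 hlt with h | ⟨h, hlt⟩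
    · exact Or.inr ⟨a', Or.inl h,
        by simp [show a ≠ a' from h.ne', hne (hi.trans hij.le) ha']⟩
    obtain rfl : a' = a := h
    rcases Prod.Lex.toLex_lt_toLex.1 hlt with h | ⟨h, hlt⟩
    · exact Or.inl ⟨i', h, by simp [show i ≠ i' from h.ne']⟩
    obtain rfl : i' = i := h
    exact Or.inr ⟨j', Or.inr ⟨hij', hlt⟩,
      by simp [show j ≠ j' from hlt.ne', (hne (hi'.trans hij'.le) ha).symm]⟩

/-! ### Counting colon variables -/

section

open Finset

variable {m n : ℕ}

theorem card_pairColon (hn : 1 ≤ n) (i j : Fin (m + n)) :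
    (pairColon hn (toLex (i, j))).card = i.1 + (j.1 - m) := by
  simp [pairColon, card_varSet, firstRight]

theorem sum_pairs (hn : 1 ≤ n) (t : ℕ) :
    ∑ k ∈ pairs m n, (pairColon hn k).card.choose t =
      ∑ i ∈ Icc 1 m, ∑ j ∈ Icc (m + 1) (m + n), Nat.choose (i + j - m - 2) t := by
  rw [sum_sigma']
  refine sum_bij (fun k _ => ⟨(ofLex k).1.1 + 1, (ofLex k).2.1 + 1⟩) ?_ ?_ ?_ ?_
  · simp only [Lex.forall, Prod.forall]
    intro i j hk
    have := (mem_filter.1 hk).2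
    have := j.2
    simp only [mem_sigma, mem_Icc, ofLex_toLex] at *
    omega
  · simp only [Lex.forall, Prod.forall]
    intro i j _ i' j' _ h
    simpa [Fin.ext_iff] using h
  · rintro ⟨i, j⟩ h
    simp only [mem_sigma, mem_Icc] at h
    refine ⟨toLex (⟨i - 1, by omega⟩, ⟨j - 1, by omega⟩), mem_filter.2 ⟨mem_univ _, ?_⟩, ?_⟩
    · simp only [ofLex_toLex]
      omega
    · simp only [ofLex_toLex, Sigma.mk.injEq, heq_eq_eq]
      omega
  · simp only [Lex.forall, Prod.forall]
    intro i j hk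
    have := (mem_filter.1 hk).2
    simp only [ofLex_toLex] at *
    rw [card_pairColon]
    congr 1
    omega

/-- With vertices numbered from 0 there are `i + (b - m)` colon variables of type `x` and `(j - i -
1) + n` of type `y`. The `i` cancels, and passing to the 1-based `j` and `k = b - m + 1` gives `n +
k + j - 3`. -/
theorem sum_leftTriples (hn : 1 ≤ n) (t : ℕ) :
    ∑ k ∈ leftTriples m n, (leftColon hn k).card.choose t =
      ∑ i ∈ Icc 1 m, ∑ j ∈ Ioc i m, ∑ k ∈ Icc 1 n, Nat.choose (n + k + j - 3) t := by
  simp only [sum_sigma']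
  refine sum_bij (fun k _ => ⟨(ofLex (ofLex k).2).1.1 + 1, (ofLex (ofLex k).2).2.1 + 1,
    (ofLex k).1.1 - m + 1⟩) ?_ ?_ ?_ ?_
  · simp only [Lex.forall, Prod.forall]
    intro b i j hk
    have := (mem_filter.1 hk).2
    have := b.2
    simp only [mem_sigma, mem_Icc, mem_Ioc, ofLex_toLex, Fin.lt_def] at *
    omega
  · simp only [Lex.forall, Prod.forall]
    intro b i j hk b' i' j' hk' h
    have hb := (mem_filter.1 hk).2.2.2
    have hb' := (mem_filter.1 hk').2.2.2
    simp only [ofLex_toLex, Sigma.mk.injEq, heq_eq_eq] at h hb hb'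
    simp only [EmbeddingLike.apply_eq_iff_eq, Prod.mk.injEq, Fin.ext_iff]
    omega
  · rintro ⟨i, j, k⟩ h
    simp only [mem_sigma, mem_Icc, mem_Ioc] at h
    refine ⟨toLex (⟨m + k - 1, by omega⟩, toLex (⟨i - 1, by omega⟩, ⟨j - 1, by omega⟩)),
      mem_filter.2 ⟨mem_univ _, ?_⟩, ?_⟩
    · simp only [ofLex_toLex, Fin.lt_def]
      omega
    · simp only [ofLex_toLex, Sigma.mk.injEq, heq_eq_eq]
      omega
  · simp only [Lex.forall, Prod.forall]
    intro b i j hk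
    obtain ⟨hij, hj, hb⟩ := (mem_filter.1 hk).2
    simp only [ofLex_toLex, Fin.lt_def] at *
    have h1 : Disjoint (Iio i) (Ico (firstRight hn) b) := disjoint_left.2 fun v hv hv' => by
      simp only [mem_Iio, mem_Ico, firstRight, Fin.lt_def, Fin.le_def] at hv hv'
      omega
    have h2 : Disjoint (Ioo i j) (Ici (firstRight hn)) := disjoint_left.2 fun v hv hv' => by
      simp only [mem_Ioo, mem_Ici, firstRight, Fin.lt_def, Fin.le_def] at hv hv'
      omega
    simp only [leftColon, card_varSet, ofLex_toLex]
    rw [card_union_of_disjoint h1, card_union_of_disjoint h2]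
    simp only [Fin.card_Iio, Fin.card_Ico, Fin.card_Ioo, Fin.card_Ici, firstRight]
    congr 1
    omega

/-- With vertices numbered from 0 the count is `i + a + (j - i - 1) = a + j - 1`. Numbering from 1,
with `j` counted within the right side, turns this into `m + k + j - 3`. -/
theorem sum_rightTriples (t : ℕ) :
    ∑ k ∈ rightTriples m n, (rightColon k).card.choose t =
      ∑ i ∈ Icc 1 n, ∑ j ∈ Ioc i n, ∑ k ∈ Icc 1 m, Nat.choose (m + k + j - 3) t := by
  simp only [sum_sigma']
  refine sum_bij (fun k _ => ⟨(ofLex (ofLex k).2).1.1 - m + 1, (ofLex (ofLex k).2).2.1 - m + 1,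
    (ofLex k).1.1 + 1⟩) ?_ ?_ ?_ ?_
  · simp only [Lex.forall, Prod.forall]
    intro a i j hk
    have := (mem_filter.1 hk).2
    have := j.2
    simp only [mem_sigma, mem_Icc, mem_Ioc, ofLex_toLex, Fin.lt_def] at *
    omega
  · simp only [Lex.forall, Prod.forall]
    intro a i j hk a' i' j' hk' h
    obtain ⟨hij, -, hi⟩ := (mem_filter.1 hk).2
    obtain ⟨hij', -, hi'⟩ := (mem_filter.1 hk').2
    simp only [ofLex_toLex, Sigma.mk.injEq, heq_eq_eq, Fin.lt_def] at h hi hi' hij hij'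
    simp only [EmbeddingLike.apply_eq_iff_eq, Prod.mk.injEq, Fin.ext_iff]
    omega
  · rintro ⟨i, j, k⟩ h
    simp only [mem_sigma, mem_Icc, mem_Ioc] at h
    refine ⟨toLex (⟨k - 1, by omega⟩, toLex (⟨m + i - 1, by omega⟩, ⟨m + j - 1, by omega⟩)),
      mem_filter.2 ⟨mem_univ _, ?_⟩, ?_⟩
    · simp only [ofLex_toLex, Fin.lt_def]
      omega
    · simp only [ofLex_toLex, Sigma.mk.injEq, heq_eq_eq]
      omega
  · simp only [Lex.forall, Prod.forall]
    intro a i j hk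
    obtain ⟨hij, ha, hi⟩ := (mem_filter.1 hk).2
    simp only [ofLex_toLex, Fin.lt_def] at *
    have h1 : Disjoint (Iio a) (Ioo i j) := disjoint_left.2 fun v hv hv' => by
      simp only [mem_Iio, mem_Ioo, Fin.lt_def] at hv hv'
      omega
    simp only [rightColon, card_varSet, ofLex_toLex, card_union_of_disjoint h1, Fin.card_Iio,
      Fin.card_Ioo]
    congr 1
    omega

end

theorem mainTheorem4 (K : Type*) [Field K] (m n : ℕ) (hn : 1 ≤ n) (hmn : n ≤ m) :
    Nonempty (MinimalGradedFreeResolution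
      (initialIdeal (edgeLex (m + n)) (binomialEdgeIdeal K (bipartiteGraph m n)))) ∧
    ∀ F : MinimalGradedFreeResolution
      (initialIdeal (edgeLex (m + n)) (binomialEdgeIdeal K (bipartiteGraph m n))), ∀ t : ℕ,
      F.betti t (t + 2) =
        ∑ i ∈ Finset.Icc 1 m, ∑ j ∈ Finset.Icc (m + 1) (m + n), Nat.choose (i + j - m - 2) t ∧
      F.betti t (t + 3) =
        (if n = 1 then
          ∑ i ∈ Finset.Icc 1 m, ∑ j ∈ Finset.Ioc i m, ∑ k ∈ Finset.Icc 1 n,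
            Nat.choose (n + k + j - 3) t
        else
          (∑ i ∈ Finset.Icc 1 m, ∑ j ∈ Finset.Ioc i m, ∑ k ∈ Finset.Icc 1 n,
            Nat.choose (n + k + j - 3) t) +
          (∑ i ∈ Finset.Icc 1 n, ∑ j ∈ Finset.Ioc i n, ∑ k ∈ Finset.Icc 1 m,
            Nat.choose (m + k + j - 3) t)) ∧
      ∀ d : ℕ, d ≠ t + 2 → d ≠ t + 3 → F.betti t d = 0 := by
  rw [initialIdeal_bipartiteGraph]
  obtain ⟨G, hG⟩ := exists_rightTriples K (m := m) hn
  refine ⟨⟨G⟩, fun F t => ?_⟩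
  simp only [betti_eq F G]
  refine ⟨?_, ?_, fun d h2 h3 => by rw [hG, if_neg h2, if_neg h3]⟩
  · rw [hG, if_pos rfl, if_neg (by omega), add_zero, sum_pairs]
  · rw [hG, if_neg (by omega), if_pos rfl, zero_add, sum_leftTriples, sum_rightTriples]
    split_ifs with h
    -- For `n = 1` there is no pair `i < j` on the right, so the second sum is empty.
    · subst h
      simp
    · rfl
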